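/- **Model.** A two-tier network consists of small base stations (SBSs, tier $s$) and macro base stations (MBSs, tier $m$). Tier $k$ has density $\lambda_k>0$, association bias $B_k>0$, total power $P_k^{tot}$, fixed circuit power $P_k^{fc}$ and amplifier coefficient $\rho_k>0$. A path of length $r$ is LoS with probability $\mathcal P_{\mathrm L}(r)=\min(18/r,1)(1-e^{-\beta r})+e^{-\beta r}$, $\beta\ge 0$, and NLoS with probability $\mathcal P_{\mathrm{NL}}=1-\mathcal P_{\mathrm L}$; its path loss in state $a\in\{\mathrm L,\mathrm{NL}\}$ is $A_a r^{-\alpha_a}$ with $A_a,\alpha_a>0$. The noise power is $N_0>0$. The library has $F\ge 1$ files, an MBS stores all of them, and an SBS stores the $C\le F$ most popular ones. The popularity is Zipf with exponent $\gamma_p$, so the cache hit ratio is $$p_h=p_h(C)=\frac{\sum_{f=1}^{C}f^{-\gamma_p}}{\sum_{g=1}^{F}g^{-\gamma_p}} .$$ With caching power coefficient $w_{ca}\ge 0$, the transmit powers are $P_s^{tr}=P'_s-w'_sC$ and $P_m^{tr}=P'_m-w'_mF$, where $P'_k=(P_k^{tot}-P_k^{fc})/\rho_k$ and $w'_k=w_{ca}/\rho_k$;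 both are assumed positive. *Access link.* The typical user sits at the origin. Its serving station, of tier $k$, is at distance $r>0$ with path state $a$. The other stations of tiers $s$ and $m$ form independent homogeneous Poisson processes $\Phi_s,\Phi_m$ of densities $\lambda_s,\lambda_m$ with independent path states (as above) and independent $\exp(1)$ fadings; the serving fading $h$ is also $\exp(1)$ and independent. The SINR is $$\mathrm{SINR}_k^{a}(r)=\frac{P_k^{tr}B_k\,h\,A_a r^{-\alpha_a}}{\sum_{j\in\{s,m\}}\sum_{i\in\Phi_j}P_j^{tr}B_j h_{j,i}L(r_{j,i})+N_0}.$$ The user is associated with the serving station if no other station of either tier has larger biased average received power $P_j^{tr}B_jL(r_{j,i})$. *Backhaul link.* A typical SBS is served by an MBS at distance $r>0$ with path state $b$. The other MBSs form a Poisson process of density $\lambda_m$, marked as before, and $\mathrm{SINR}_{bh}^{b}(r)$ is defined in the same way with interference from these MBSs only; association means that none of them is stronger on average. The fadings and stations seen on the backhaul link are independent of those seen on the access link. For a threshold $\gamma\ge 0$ let $$\mathbb P^{cov}_{k,a}(\gamma\mid r)=\mathbb P[\mathrm{SINR}_k^a(r)>\gamma],\qquad \mathbb P^{cov}_{bh,b}(\gamma\mid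 r)=\mathbb P[\mathrm{SINR}_{bh}^b(r)>\gamma],$$ conditionally on the corresponding association. A fraction $\eta$ of the bandwidth is used for access and $1-\eta$ for backhaul. The spectral efficiency of a user served by an SBS is $$R_s=\min\Big\{\eta\log_2\big(1+\mathrm{SINR}_s^a(r_s)\big),\ \tfrac{1-\eta}{1-p_h}\log_2\big(1+\mathrm{SINR}_{bh}^b(r_{bh})\big)\Big\}$$ (if $p_h=1$, the second term is $+\infty$ when $\mathrm{SINR}_{bh}^b>0$ and $0$ otherwise), and that of a user served by an MBS is $R_m=\eta\log_2(1+\mathrm{SINR}_m^a(r_m))$. **Proposition.** 1) (User served by an SBS.) Let $0<\eta<1$, $\rho\ge 0$ and $r_s,r_{bh}>0$. In each of the four cases $a,b\in\{\mathrm L,\mathrm{NL}\}$ for the states of the access and the backhaul link, conditionally on both associations, $$\mathbb P[R_s>\rho]=\mathbb P^{cov}_{s,a}\big(2^{\rho/\eta}-1\mid r_s\big)\cdot\mathbb P^{cov}_{bh,b}\big(2^{(1-p_h)\rho/(1-\eta)}-1\mid r_{bh}\big).$$ 2) (User served by an MBS.) Let $0<\eta\le 1$, $\rho\ge 0$ and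 $r_m>0$. For $a\in\{\mathrm L,\mathrm{NL}\}$, conditionally on the association, $$\mathbb P[R_m>\rho]=\mathbb P^{cov}_{m,a}\big(2^{\rho/\eta}-1\mid r_m\big).$$ Here the coverage probabilities are, for $k\in\{s,m\}$, $a,b\in\{\mathrm L,\mathrm{NL}\}$ and $r,\gamma>0$, $$\mathbb P^{cov}_{k,a}(\gamma\mid r)=\exp\Big(\frac{-\gamma N_0}{P_k^{tr}B_kA_ar^{-\alpha_a}}\Big)\prod_{j\in\{s,m\}}\mathcal L^{j}_{k,a}(\gamma,r),\qquad \mathbb P^{cov}_{bh,b}(\gamma\mid r)=\exp\Big(\frac{-\gamma N_0}{P_m^{tr}B_mA_br^{-\alpha_b}}\Big)\mathcal L^{m}_{m,b}(\gamma,r),$$ $$\mathcal L^{j}_{k,a}(\gamma,r)=\exp\Bigg(-2\pi\lambda_j\sum_{c\in\{\mathrm L,\mathrm{NL}\}}\int_{R_c}^{\infty}\frac{\mathcal P_c(u)\,u}{1+\frac{P_k^{tr}B_kA_ar^{-\alpha_a}}{\gamma P_j^{tr}B_jA_cu^{-\alpha_c}}}\,du\Bigg),\qquad R_c=\Big(\frac{P_k^{tr}B_kA_a}{P_j^{tr}B_jA_c}\Big)^{-1/\alpha_c}r^{\alpha_a/\alpha_c},$$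 with $\exp(-\infty)=0$ if an integral diverges. -/

import Mathlib

open MeasureTheory ProbabilityTheory
open scoped ENNReal

noncomputable section

namespace MmWave

/-! ### Poisson point processes -/

/-- `Φ` is a (simple) Poisson point process on `E` with intensity measure `μ`: the random set `Φ ω`
is countable, the number of points in a measurable set `A` is a random variable, it has the Poisson
law with mean `μ A` when `μ A` is finite, and the numbers of points in pairwise disjoint sets are
independent. -/
structure IsPoissonProcess {Ω E : Type*} [MeasurableSpace Ω] [MeasurableSpace E]
    (P : Measure Ω) (μ : Measure E) (Φ : Ω → Set E) : Prop where
  countable : ∀ ω, (Φ ω).Countable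
  measurable : ∀ A, MeasurableSet A → Measurable fun ω => (Φ ω ∩ A).encard
  law : ∀ A, MeasurableSet A → μ A < ∞ →
    P.map (fun ω => (Φ ω ∩ A).encard)
      = (poissonMeasure (μ A).toNNReal).map (fun n : ℕ => (n : ℕ∞))
  indep : ∀ (n : ℕ) (A : Fin n → Set E), (∀ i, MeasurableSet (A i)) →
    Pairwise (fun i j => Disjoint (A i) (A j)) →
    iIndepFun (fun i ω => (Φ ω ∩ A i).encard) P

/-- The σ-algebra generated by a random point set, i.e. by all its counting variables. -/
@[reducible] def pointSigma {Ω E : Type*} [MeasurableSpace E] (Φ : Ω → Set E) : MeasurableSpace Ω :=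
  ⨆ A : {A : Set E // MeasurableSet A},
    MeasurableSpace.comap (fun ω => (Φ ω ∩ A.1).encard) inferInstance

/-! ### The network -/

/-- The two tiers: small base stations (SBSs) and macro base stations (MBSs). -/
inductive Tier
  | sbs
  | mbs

/-- A propagation path is line-of-sight (LoS) or non-line-of-sight (NLoS). -/
inductive LinkState
  | los
  | nlos

instance : MeasurableSpace LinkState := ⊤

/-- A base station as seen from a receiver at the origin: its position, the LoS/NLoS state of its
path to the receiver, and its small-scale fading power gain. -/
abbrev MarkedBS : Type := EuclideanSpace ℝ (Fin 2) × LinkState × ℝ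

/-- The deterministic parameters of the network. -/
structure Network where
  /-- density `λ_k` of the base stations of tier `k` -/
  density : Tier → ℝ
  /-- total power `P_k^tot` -/
  totalPower : Tier → ℝ
  /-- fixed circuit power `P_k^fc` -/
  circuitPower : Tier → ℝ
  /-- amplifier and cooling coefficient `ρ_k` -/
  amplifier : Tier → ℝ
  /-- association bias `B_k` -/
  bias : Tier → ℝ
  /-- caching power coefficient `w_ca` per file unit -/
  cachePower : ℝ
  /-- path loss gains `A_L`, `A_NL` -/
  gain : LinkState → ℝ
  /-- path loss exponents `α_L`, `α_NL` -/
  exponent : LinkState → ℝ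
  /-- blockage parameter `β` -/
  blockage : ℝ
  /-- noise power `N₀` -/
  noise : ℝ
  /-- number `F` of files in the library -/
  files : ℕ
  /-- Zipf exponent `γ_p` -/
  zipfExponent : ℝ
  density_pos : ∀ k, 0 < density k
  amplifier_pos : ∀ k, 0 < amplifier k
  bias_pos : ∀ k, 0 < bias k
  cachePower_nonneg : 0 ≤ cachePower
  gain_pos : ∀ a, 0 < gain a
  exponent_pos : ∀ a, 0 < exponent a
  blockage_nonneg : 0 ≤ blockage
  noise_pos : 0 < noise
  files_pos : 0 < files

namespace Network

variable (N : Network)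

/-- Cache hit ratio `p_h(C)` of an SBS that stores the `C` most popular of the `F` files, the
popularity of the `f`-th file being proportional to `f ^ (-γ_p)`. -/
def hitRatio (C : ℕ) : ℝ :=
  (∑ f ∈ Finset.Icc 1 C, (f : ℝ) ^ (-N.zipfExponent)) /
    ∑ g ∈ Finset.Icc 1 N.files, (g : ℝ) ^ (-N.zipfExponent)

/-- Number of cached files: `C` in an SBS, the whole library in an MBS. -/
def cacheSize (C : ℕ) : Tier → ℕ
  | .sbs => C
  | .mbs => N.files

/-- `P'_k = (P_k^tot - P_k^fc) / ρ_k`. -/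
def basePower (k : Tier) : ℝ := (N.totalPower k - N.circuitPower k) / N.amplifier k

/-- `w'_k = w_ca / ρ_k`. -/
def cacheCoeff (k : Tier) : ℝ := N.cachePower / N.amplifier k

/-- Transmit power: `P'_s - w'_s C` for an SBS and `P'_m - w'_m F` for an MBS. -/
def txPower (C : ℕ) (k : Tier) : ℝ := N.basePower k - N.cacheCoeff k * N.cacheSize C k

/-- LoS probability at distance `r`. -/
def losProb (r : ℝ) : ℝ :=
  min (18 / r) 1 * (1 - Real.exp (-N.blockage * r)) + Real.exp (-N.blockage * r)

/-- Probability that a path of length `r` is in state `a`. -/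
def linkProb (a : LinkState) (r : ℝ) : ℝ :=
  match a with
  | .los => N.losProb r
  | .nlos => 1 - N.losProb r

/-- Path loss `A_a r ^ (-α_a)`. -/
def pathLoss (a : LinkState) (r : ℝ) : ℝ := N.gain a * r ^ (-N.exponent a)

/-- Biased power `P_k B_k A_a r ^ (-α_a)` received, on average over the fading (which has mean one),
from a base station of tier `k` at distance `r` on a path in state `a`. -/
def meanPower (C : ℕ) (k : Tier) (a : LinkState) (r : ℝ) : ℝ :=
  N.txPower C k * N.bias k * N.pathLoss a r

/-- Intensity of the marked base stations of tier `k`: the positions are a homogeneous Poisson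
process of density `λ_k`, and independently for each station the path is LoS with the LoS
probability of its length and the fading is exponential with mean one. -/
def bsIntensity (k : Tier) : Measure MarkedBS :=
  ENNReal.ofReal (N.density k) •
    ((volume : Measure (EuclideanSpace ℝ (Fin 2))).prod
      ((Measure.count : Measure LinkState).prod (expMeasure 1))).withDensity
      (fun z => ENNReal.ofReal (N.linkProb z.2.1 ‖z.1‖))

/-- The random environment.
* `h` is the fading of the access link of the typical user, and `Φ k` are the base stations of
  tier `k` other than the serving one, seen from the typical user.
* `hb` is the fading of the backhaul link of the typical SBS, and `Ψ` are the MBSs other than the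
  serving one, seen from the typical SBS.

The fadings are exponential with mean one (Rayleigh fading), the base stations are Poisson, and
all of this is independent. -/
structure IsEnvironment {Ω : Type*} [MeasurableSpace Ω] (P : Measure Ω)
    (h : Ω → ℝ) (Φ : Tier → Ω → Set MarkedBS) (hb : Ω → ℝ) (Ψ : Ω → Set MarkedBS) : Prop where
  access_measurable : Measurable h
  access_law : P.map h = expMeasure 1
  access_poisson : ∀ k, IsPoissonProcess P (N.bsIntensity k) (Φ k)
  backhaul_measurable : Measurable hb
  backhaul_law : P.map hb = expMeasure 1
  backhaul_poisson : IsPoissonProcess P (N.bsIntensity .mbs) Ψ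
  indep : iIndep
    (![MeasurableSpace.comap h inferInstance, pointSigma (Φ .sbs), pointSigma (Φ .mbs),
      MeasurableSpace.comap hb inferInstance, pointSigma Ψ] : Fin 5 → MeasurableSpace Ω) P

/-! ### Association, SINR, coverage -/

section Links

variable {Ω : Type*}

/-- Power received from all stations of tier `k` in the configuration `S`, i.e. the sum of
`P_k B_k h_i L(r_i)`. -/
def totalReceived (C : ℕ) (k : Tier) (S : Set MarkedBS) : ℝ≥0∞ :=
  ∑' z : S, ENNReal.ofReal
    (N.txPower C k * N.bias k * z.1.2.2 * N.pathLoss z.1.2.1 ‖z.1.1‖)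

/-- No station of tier `j` in the configuration `S` is stronger, in biased average received power,
than a serving station of tier `k` at distance `r` with a path in state `a`. -/
def NoneStronger (C : ℕ) (k : Tier) (a : LinkState) (r : ℝ) (j : Tier) (S : Set MarkedBS) : Prop :=
  ∀ z ∈ S, N.meanPower C j z.2.1 ‖z.1‖ ≤ N.meanPower C k a r

/-- The event that the typical user is associated with the station of tier `k` at distance `r`
(path state `a`): all other stations of both tiers are at most as strong. -/
def userAssociated (C : ℕ) (k : Tier) (a : LinkState) (r : ℝ)
    (Φ : Tier → Ω → Set MarkedBS) : Set Ω :=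
  {ω | ∀ j, N.NoneStronger C k a r j (Φ j ω)}

/-- The event that the typical SBS is associated with the MBS at distance `r` (path state `a`). -/
def backhaulAssociated (C : ℕ) (a : LinkState) (r : ℝ) (Ψ : Ω → Set MarkedBS) : Set Ω :=
  {ω | N.NoneStronger C .mbs a r .mbs (Ψ ω)}

/-- SINR of the typical user served by a station of tier `k` at distance `r` with path state `a`. -/
def accessSINR (C : ℕ) (k : Tier) (a : LinkState) (r : ℝ)
    (h : Ω → ℝ) (Φ : Tier → Ω → Set MarkedBS) (ω : Ω) : ℝ≥0∞ :=
  ENNReal.ofReal (N.txPower C k * N.bias k * h ω * N.pathLoss a r) /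
    (N.totalReceived C .sbs (Φ .sbs ω) + N.totalReceived C .mbs (Φ .mbs ω)
      + ENNReal.ofReal N.noise)

/-- SINR of the typical SBS on its backhaul link from an MBS at distance `r` with path state `a`. -/
def backhaulSINR (C : ℕ) (a : LinkState) (r : ℝ)
    (hb : Ω → ℝ) (Ψ : Ω → Set MarkedBS) (ω : Ω) : ℝ≥0∞ :=
  ENNReal.ofReal (N.txPower C .mbs * N.bias .mbs * hb ω * N.pathLoss a r) /
    (N.totalReceived C .mbs (Ψ ω) + ENNReal.ofReal N.noise)

variable [MeasurableSpace Ω]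

/-- Access coverage probability `P_{k,a}^cov(γ | r) = ℙ[SINR > γ]`, given the association. -/
def accessCoverage (P : Measure Ω) (C : ℕ) (k : Tier) (a : LinkState) (r : ℝ)
    (h : Ω → ℝ) (Φ : Tier → Ω → Set MarkedBS) (γ : ℝ) : ℝ≥0∞ :=
  cond P (N.userAssociated C k a r Φ) {ω | ENNReal.ofReal γ < N.accessSINR C k a r h Φ ω}

/-- Backhaul coverage probability `P_{bh,a}^cov(γ | r) = ℙ[SINR > γ]`, given the association. -/
def backhaulCoverage (P : Measure Ω) (C : ℕ) (a : LinkState) (r : ℝ)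
    (hb : Ω → ℝ) (Ψ : Ω → Set MarkedBS) (γ : ℝ) : ℝ≥0∞ :=
  cond P (N.backhaulAssociated C a r Ψ) {ω | ENNReal.ofReal γ < N.backhaulSINR C a r hb Ψ ω}

end Links

/-! ### Spectral efficiency -/

/-- Spectral efficiency of a user served by an SBS,
`min {η log₂(1 + SINR_s), (1 - η) / (1 - p_h) * log₂(1 + SINR_bh)}`, with states `a`, `b` and
distances `rs`, `rb` of the access link and of the backhaul link. The values are extended
nonnegative reals: the second term is `∞` if `p_h = 1` and `SINR_bh > 0`. -/
def sbsEfficiency {Ω : Type*} (C : ℕ) (η : ℝ) (a b : LinkState) (rs rb : ℝ)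
    (h : Ω → ℝ) (Φ : Tier → Ω → Set MarkedBS) (hb : Ω → ℝ) (Ψ : Ω → Set MarkedBS)
    (ω : Ω) : ℝ≥0∞ :=
  min (ENNReal.ofReal (η * Real.logb 2 (1 + (N.accessSINR C .sbs a rs h Φ ω).toReal)))
    (ENNReal.ofReal ((1 - η) * Real.logb 2 (1 + (N.backhaulSINR C b rb hb Ψ ω).toReal)) /
      ENNReal.ofReal (1 - N.hitRatio C))

/-- Spectral efficiency `η log₂(1 + SINR_m)` of a user served by an MBS. -/
def mbsEfficiency {Ω : Type*} (C : ℕ) (η : ℝ) (a : LinkState) (r : ℝ)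
    (h : Ω → ℝ) (Φ : Tier → Ω → Set MarkedBS) (ω : Ω) : ℝ≥0∞ :=
  ENNReal.ofReal (η * Real.logb 2 (1 + (N.accessSINR C .mbs a r h Φ ω).toReal))

/-! ### The closed form of the coverage probabilities -/

/-- Distance beyond which the stations of tier `j` with path state `b` must lie, given a serving
station of tier `k` at distance `r` with path state `a`. -/
def exclusionRadius (C : ℕ) (k : Tier) (a : LinkState) (r : ℝ) (j : Tier) (b : LinkState) : ℝ :=
  (N.txPower C k * N.bias k * N.gain a / (N.txPower C j * N.bias j * N.gain b))
      ^ (-1 / N.exponent b)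
    * r ^ (N.exponent a / N.exponent b)

/-- The integral
`∫_{R}^∞ 𝒫_b(u) u / (1 + P_k B_k A_a r^{-α_a} / (γ P_j B_j A_b u^{-α_b})) du`
with `R` the exclusion radius (possibly `∞`). -/
def interferenceIntegral (C : ℕ) (k : Tier) (a : LinkState) (r γ : ℝ) (j : Tier) (b : LinkState) :
    ℝ≥0∞ :=
  ∫⁻ u in Set.Ioi (N.exclusionRadius C k a r j b),
    ENNReal.ofReal (N.linkProb b u * u / (1 + N.meanPower C k a r / (γ * N.meanPower C j b u)))

/-- Laplace transform of the interference caused by tier `j`,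
`exp (-2 π λ_j (I_los + I_nlos))`, where `exp (-∞) = 0`. -/
def interferenceLaplace (C : ℕ) (k : Tier) (a : LinkState) (r γ : ℝ) (j : Tier) : ℝ≥0∞ :=
  EReal.exp (-((ENNReal.ofReal (2 * Real.pi * N.density j) *
    (N.interferenceIntegral C k a r γ j .los + N.interferenceIntegral C k a r γ j .nlos) :
      ℝ≥0∞) : EReal))

/-- The noise factor `exp (-γ N₀ / (P_k B_k A_a r^{-α_a}))`. -/
def noiseFactor (C : ℕ) (k : Tier) (a : LinkState) (r γ : ℝ) : ℝ≥0∞ :=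
  ENNReal.ofReal (Real.exp (-γ * N.noise / N.meanPower C k a r))

end Network

end MmWave

end

/-! With Rayleigh fading, SINR > γ says that a unit exponential variable exceeds an affine function
of the interference. By independence its probability is the noise factor times the Laplace transform
of the interference at γ / M, where M is the mean power of the serving station. For Poisson sums
this transform follows from the Laplace functional E exp(-Σ f) = exp(-∫ (1 - exp(-f)) dμ), which is
`IsPoissonProcess.lintegral_expNeg_tsum`; it reduces to independent Poisson counts when f is simple
and passes to the limit otherwise.

Conditioning on the association is absorbed into the same functional by letting f be infinite: give
every station stronger than the serving one the weight ∞. Then exp(-Σ weights) is the indicator of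
the association event, so both the probability of association and that of association with coverage
are Laplace functionals. Averaging over fading, link state and angle (`lintegral_bsIntensity`)
splits the exponent at the exclusion radii. The inner part, `voidMass`, is finite and common to
numerator and denominator, so it cancels; the outer part is the exponent of `interferenceLaplace`.
This gives `accessCoverage_eq` and `backhaulCoverage_eq`.

For the spectral efficiency, a minimum exceeds ρ exactly when both terms do, and each term inverts
to an SINR threshold. Access and backhaul quantities generate independent σ-algebras, so the
conditional probability factors (`cond_sbsEfficiency`).

All values lie in [0, ∞] with exp(-∞) = 0, so infinite interference and divergent integrals are
covered by the same formulas. -/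

namespace MmWave

/-! ### The map `x ↦ exp (-x)` on the extended nonnegative reals -/

/-- `exp (-x)` for `x` in `[0, ∞]`, with `exp (-∞) = 0`. -/
noncomputable def expNeg (x : ℝ≥0∞) : ℝ≥0∞ := EReal.exp (-(x : EReal))

@[simp] lemma expNeg_zero : expNeg 0 = 1 := by simp [expNeg]

@[simp] lemma expNeg_top : expNeg ∞ = 0 := by simp [expNeg]

lemma expNeg_add (x y : ℝ≥0∞) : expNeg (x + y) = expNeg x * expNeg y := by
  unfold expNeg
  rw [EReal.coe_ennreal_add, ← EReal.exp_add]
  congr 1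
  rw [EReal.neg_add (Or.inl (EReal.coe_ennreal_ne_bot x)) (Or.inr (EReal.coe_ennreal_ne_bot y)),
    sub_eq_add_neg]

lemma expNeg_ofReal {x : ℝ} (hx : 0 ≤ x) :
    expNeg (ENNReal.ofReal x) = ENNReal.ofReal (Real.exp (-x)) := by
  unfold expNeg
  rw [EReal.coe_ennreal_ofReal, max_eq_left hx, ← EReal.coe_neg, EReal.exp_coe]

lemma expNeg_le_one (x : ℝ≥0∞) : expNeg x ≤ 1 := by
  unfold expNeg
  simp [EReal.exp_le_one_iff, EReal.coe_ennreal_nonneg]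

lemma continuous_expNeg : Continuous expNeg :=
  ENNReal.continuous_exp.comp (continuous_neg.comp continuous_coe_ennreal_ereal)

@[fun_prop]
lemma measurable_expNeg : Measurable expNeg := continuous_expNeg.measurable

lemma expNeg_antitone : Antitone expNeg := fun x y hxy => by
  unfold expNeg
  simpa [EReal.exp_le_exp_iff] using hxy

lemma expNeg_eq_zero_iff {x : ℝ≥0∞} : expNeg x = 0 ↔ x = ∞ := by
  simp [expNeg]

lemma expNeg_sum {ι : Type*} (s : Finset ι) (f : ι → ℝ≥0∞) :
    expNeg (∑ i ∈ s, f i) = ∏ i ∈ s, expNeg (f i) := by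
  induction s using Finset.cons_induction with
  | empty => simp
  | cons a s ha ih => rw [Finset.sum_cons, Finset.prod_cons, expNeg_add, ih]

/-! ### Sums over random point sets -/

section Point

variable {Ω E : Type*} [MeasurableSpace E]

lemma measurable_encard_pointSigma (Φ : Ω → Set E) {A : Set E} (hA : MeasurableSet A) :
    Measurable[pointSigma Φ] fun ω => (Φ ω ∩ A).encard := by
  apply Measurable.of_comap_le
  exact le_iSup (fun A : {A : Set E // MeasurableSet A} =>
    MeasurableSpace.comap (fun ω => (Φ ω ∩ A.1).encard) inferInstance) ⟨A, hA⟩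

variable [MeasurableSingletonClass E]

/-- Seeing a sum over the points as an integral against a counting measure makes simple functions
and monotone convergence available. -/
lemma tsum_eq_lintegral_count_restrict {S : Set E} (hS : S.Countable) (f : E → ℝ≥0∞) :
    ∑' z : S, f z = ∫⁻ z, f z ∂(Measure.count.restrict S) := by
  rw [lintegral_countable _ hS]
  simp

lemma count_restrict_apply {S : Set E} (hS : S.Countable) {A : Set E} (hA : MeasurableSet A) :
    (Measure.count.restrict S) A = ((S ∩ A).encard : ℝ≥0∞) := by
  rw [Measure.restrict_apply hA, Set.inter_comm,
    Measure.count_apply (hS.mono Set.inter_subset_left).measurableSet]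

/-- The random counting measure is a measurable map into `Measure E`, since its values on measurable
sets are the counting variables; integrating a fixed function is measurable on `Measure E`. Working
with `pointSigma Φ` instead of the ambient σ-algebra is what lets independence apply later. -/
lemma measurable_tsum_pointSigma {Φ : Ω → Set E} (hΦ : ∀ ω, (Φ ω).Countable) {f : E → ℝ≥0∞}
    (hf : Measurable f) : Measurable[pointSigma Φ] fun ω => ∑' z : Φ ω, f z := by
  have h1 : Measurable[pointSigma Φ] fun ω => (Measure.count : Measure E).restrict (Φ ω) := by
    refine @Measure.measurable_of_measurable_coe _ _ _ (pointSigma Φ) _ fun A hA => ?_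
    simp_rw [count_restrict_apply (hΦ _) hA]
    exact (measurable_of_countable (fun n : ℕ∞ => (n : ℝ≥0∞))).comp
      (measurable_encard_pointSigma Φ hA)
  simp_rw [tsum_eq_lintegral_count_restrict (hΦ _) f]
  exact (Measure.measurable_lintegral hf).comp h1

end Point

/-! ### The Laplace functional of a Poisson process -/

/-- The Laplace transform of the Poisson law, by the exponential series in m exp(-c). -/
lemma lintegral_poissonMeasure_expNeg (m : NNReal) {c : ℝ≥0∞} (hc : c ≠ ∞) :
    ∫⁻ n : ℕ, expNeg (c * n) ∂(poissonMeasure m) = expNeg ((1 - expNeg c) * m) := by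
  lift c to NNReal using hc
  have hq : expNeg (c : ℝ≥0∞) = ENNReal.ofReal (Real.exp (-c)) := by
    rw [← expNeg_ofReal c.coe_nonneg, ENNReal.ofReal_coe_nnreal]
  have hR : expNeg ((1 - expNeg (c : ℝ≥0∞)) * m)
      = ENNReal.ofReal (Real.exp (-m) * Real.exp (m * Real.exp (-c))) := by
    have h1 : Real.exp (-(c : ℝ)) ≤ 1 := Real.exp_le_one_iff.2 (by simp)
    rw [hq, ← ENNReal.ofReal_one, ← ENNReal.ofReal_sub _ (Real.exp_nonneg _),
      ← ENNReal.ofReal_coe_nnreal (p := m), ← ENNReal.ofReal_mul (sub_nonneg.2 h1),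
      expNeg_ofReal (mul_nonneg (sub_nonneg.2 h1) m.coe_nonneg), ← Real.exp_add]
    congr 2
    ring
  have hs : HasSum (fun n : ℕ => Real.exp (-m) * ((m * Real.exp (-c)) ^ n / n.factorial))
      (Real.exp (-m) * Real.exp (m * Real.exp (-c))) := by
    apply HasSum.mul_left
    rw [Real.exp_eq_exp_ℝ]
    exact NormedSpace.expSeries_div_hasSum_exp (_ : ℝ)
  rw [hR, ← hs.tsum_eq, ENNReal.ofReal_tsum_of_nonneg (fun n => by positivity) hs.summable,
    poissonMeasure, lintegral_sum_measure]
  refine tsum_congr fun n => ?_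
  have h2 : expNeg ((c : ℝ≥0∞) * n) = ENNReal.ofReal (Real.exp (-c) ^ n) := by
    have : (c : ℝ≥0∞) * n = ENNReal.ofReal (c * n) := by
      rw [ENNReal.ofReal_mul c.coe_nonneg]; simp
    rw [this, expNeg_ofReal (by positivity), ← Real.exp_nat_mul]
    congr 2
    ring
  rw [lintegral_smul_measure, lintegral_dirac, h2, smul_eq_mul,
    ← ENNReal.ofReal_mul (by positivity)]
  congr 1
  rw [mul_pow]
  ring

namespace IsPoissonProcess

variable {Ω E : Type*} [MeasurableSpace Ω] [MeasurableSpace E] {P : Measure Ω} {μ : Measure E}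
  {Φ : Ω → Set E}

lemma pointSigma_le (hΦ : IsPoissonProcess P μ Φ) : pointSigma Φ ≤ ‹MeasurableSpace Ω› :=
  iSup_le fun A => (hΦ.measurable A.1 A.2).comap_le

lemma lintegral_expNeg_encard (hΦ : IsPoissonProcess P μ Φ) {A : Set E} (hA : MeasurableSet A)
    (hμ : μ A ≠ ∞) {c : ℝ≥0∞} (hc : c ≠ ∞) :
    ∫⁻ ω, expNeg (c * ((Φ ω ∩ A).encard : ℝ≥0∞)) ∂P = expNeg ((1 - expNeg c) * μ A) := by
  have h1 : Measurable fun n : ℕ∞ => expNeg (c * (n : ℝ≥0∞)) := measurable_of_countable _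
  rw [← lintegral_map (f := fun n : ℕ∞ => expNeg (c * (n : ℝ≥0∞))) h1 (hΦ.measurable A hA),
    hΦ.law A hA hμ.lt_top, lintegral_map h1 (measurable_of_countable _)]
  simp only [ENat.toENNReal_coe]
  rw [lintegral_poissonMeasure_expNeg _ hc, ENNReal.coe_toNNReal hμ]

variable [MeasurableSingletonClass E]

lemma measurable_tsum (hΦ : IsPoissonProcess P μ Φ) {f : E → ℝ≥0∞} (hf : Measurable f) :
    Measurable fun ω => ∑' z : Φ ω, f z :=
  (measurable_tsum_pointSigma hΦ.countable hf).mono hΦ.pointSigma_le le_rfl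

/-- The Laplace functional at a simple function restricted to a set of finite measure. -/
lemma lintegral_expNeg_tsum_simpleFunc (hΦ : IsPoissonProcess P μ Φ) (g : SimpleFunc E ℝ≥0∞)
    (hg : ∀ z, g z ≠ ∞) {S : Set E} (hS : MeasurableSet S) (hμ : μ S ≠ ∞) :
    ∫⁻ ω, expNeg (∑' z : Φ ω, S.indicator g z) ∂P
      = expNeg (∫⁻ z, (1 - expNeg (S.indicator g z)) ∂μ) := by
  have hA : ∀ y, MeasurableSet (g ⁻¹' {y} ∩ S) := fun y => (g.measurableSet_fiber y).inter hS
  have h1 : ∀ ω, ∑' z : Φ ω, S.indicator g z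
      = ∑ y ∈ g.range, y * ((Φ ω ∩ (g ⁻¹' {y} ∩ S)).encard : ℝ≥0∞) := fun ω => by
    rw [tsum_eq_lintegral_count_restrict (hΦ.countable ω), lintegral_indicator hS,
      SimpleFunc.lintegral_eq_lintegral, SimpleFunc.lintegral]
    refine Finset.sum_congr rfl fun y _ => ?_
    rw [Measure.restrict_apply (g.measurableSet_fiber y),
      count_restrict_apply (hΦ.countable ω) (hA y)]
  have h2 : ∫⁻ z, (1 - expNeg (S.indicator g z)) ∂μ
      = ∑ y ∈ g.range, (1 - expNeg y) * μ (g ⁻¹' {y} ∩ S) := by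
    have : (fun z => 1 - expNeg (S.indicator g z))
        = S.indicator (g.map fun y => 1 - expNeg y) := by
      ext z
      by_cases hz : z ∈ S <;> simp [hz]
    rw [this, lintegral_indicator hS, SimpleFunc.lintegral_eq_lintegral, SimpleFunc.map_lintegral]
    refine Finset.sum_congr rfl fun y _ => ?_
    rw [Measure.restrict_apply (g.measurableSet_fiber y)]
  -- Independence of counts is given for families indexed by `Fin n`, so the values of `g` are
  -- enumerated; the fibres over distinct values are disjoint.
  let e := g.range.equivFin.symm
  have hind := hΦ.indep _ (fun i => g ⁻¹' {(e i : ℝ≥0∞)} ∩ S) (fun i => hA _) (by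
    intro i j hij
    refine Set.disjoint_left.2 fun z hz hz' => hij (e.injective (Subtype.ext ?_))
    exact (hz.1 : g z = _).symm.trans hz'.1)
  have hind' := hind.comp (fun i n => expNeg ((e i : ℝ≥0∞) * (n : ℝ≥0∞)))
    (fun i => measurable_of_countable _)
  have h3 := lintegral_prod_eq_prod_lintegral_of_indepFun Finset.univ _ hind' (fun i =>
    (measurable_of_countable (fun n : ℕ∞ => expNeg ((e i : ℝ≥0∞) * (n : ℝ≥0∞)))).comp
      (hΦ.measurable _ (hA _)))
  have h4 : ∀ F : ℝ≥0∞ → ℝ≥0∞, ∏ i, F (e i) = ∏ y ∈ g.range, F y := fun F => by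
    rw [Equiv.prod_comp e (fun y => F y), Finset.prod_coe_sort g.range F]
  simp only [Function.comp_apply] at h3
  rw [h2, expNeg_sum]
  simp_rw [h1, expNeg_sum]
  have h5 : ∀ ω, ∏ i, expNeg ((e i : ℝ≥0∞) * ((Φ ω ∩ (g ⁻¹' {(e i : ℝ≥0∞)} ∩ S)).encard : ℝ≥0∞))
      = ∏ y ∈ g.range, expNeg (y * ((Φ ω ∩ (g ⁻¹' {y} ∩ S)).encard : ℝ≥0∞)) := fun ω =>
    h4 fun y => expNeg (y * ((Φ ω ∩ (g ⁻¹' {y} ∩ S)).encard : ℝ≥0∞))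
  simp_rw [h5] at h3
  rw [h3, h4 fun y => ∫⁻ ω, expNeg (y * ((Φ ω ∩ (g ⁻¹' {y} ∩ S)).encard : ℝ≥0∞)) ∂P]
  refine Finset.prod_congr rfl fun y hy => ?_
  obtain ⟨z, rfl⟩ := SimpleFunc.mem_range.1 hy
  exact hΦ.lintegral_expNeg_encard (hA _)
    (ne_top_of_le_ne_top hμ (measure_mono Set.inter_subset_right)) (hg z)

/-- The Laplace functional of a Poisson process with σ-finite intensity. -/
theorem lintegral_expNeg_tsum [IsProbabilityMeasure P] [SigmaFinite μ]
    (hΦ : IsPoissonProcess P μ Φ) {f : E → ℝ≥0∞} (hf : Measurable f) :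
    ∫⁻ ω, expNeg (∑' z : Φ ω, f z) ∂P = expNeg (∫⁻ z, (1 - expNeg (f z)) ∂μ) := by
  -- Finite-valued simple functions cut off to sets of finite measure, increasing to `f`. The limit
  -- `f` may take the value ∞, which the association weights need.
  let g : ℕ → E → ℝ≥0∞ := fun n => (spanningSets μ n).indicator (SimpleFunc.eapprox f n)
  have hgm : ∀ n, Measurable (g n) := fun n =>
    (SimpleFunc.eapprox f n).measurable.indicator (measurableSet_spanningSets μ n)
  have hmono : Monotone g := fun m n hmn z =>
    (Set.indicator_le_indicator (SimpleFunc.monotone_eapprox f hmn z)).trans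
      (Set.indicator_le_indicator_of_subset (monotone_spanningSets μ hmn) (fun _ => zero_le) z)
  have hlim : ∀ z, Filter.Tendsto (fun n => g n z) Filter.atTop (nhds (f z)) := fun z => by
    have h1 := tendsto_atTop_iSup (fun m n hmn => SimpleFunc.monotone_eapprox f hmn z)
    rw [SimpleFunc.iSup_eapprox_apply hf] at h1
    refine h1.congr' ?_
    filter_upwards [Filter.eventually_ge_atTop (spanningSetsIndex μ z)] with n hn
    simp [g, monotone_spanningSets μ hn (mem_spanningSetsIndex μ z)]
  have hL : Filter.Tendsto (fun n => ∫⁻ ω, expNeg (∑' z : Φ ω, g n z) ∂P) Filter.atTop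
      (nhds (∫⁻ ω, expNeg (∑' z : Φ ω, f z) ∂P)) := by
    refine tendsto_lintegral_of_dominated_convergence (fun _ => 1)
      (fun n => measurable_expNeg.comp (hΦ.measurable_tsum (hgm n)))
      -- The outer integrands decrease in n, so domination by 1 replaces monotone convergence; the
      -- inner sums do increase.
      (fun n => ae_of_all _ fun ω => expNeg_le_one _) (by simp) (ae_of_all _ fun ω => ?_)
    refine (continuous_expNeg.tendsto _).comp ?_
    simp_rw [tsum_eq_lintegral_count_restrict (hΦ.countable ω)]
    exact lintegral_tendsto_of_tendsto_of_monotone (fun n => (hgm n).aemeasurable)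
      (ae_of_all _ fun z m n hmn => hmono hmn z) (ae_of_all _ hlim)
  have hR : Filter.Tendsto (fun n => expNeg (∫⁻ z, (1 - expNeg (g n z)) ∂μ)) Filter.atTop
      (nhds (expNeg (∫⁻ z, (1 - expNeg (f z)) ∂μ))) := by
    refine (continuous_expNeg.tendsto _).comp ?_
    refine lintegral_tendsto_of_tendsto_of_monotone
      (fun n => (measurable_const.sub (measurable_expNeg.comp (hgm n))).aemeasurable)
      (ae_of_all _ fun z m n hmn => tsub_le_tsub_left (expNeg_antitone (hmono hmn z)) _)
      (ae_of_all _ fun z => ?_)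
    exact ENNReal.Tendsto.sub tendsto_const_nhds ((continuous_expNeg.tendsto _).comp (hlim z))
      (Or.inl ENNReal.one_ne_top)
  refine tendsto_nhds_unique hL (hR.congr fun n => ?_)
  exact (hΦ.lintegral_expNeg_tsum_simpleFunc _ (fun z => (SimpleFunc.eapprox_lt_top f n z).ne)
    (measurableSet_spanningSets μ n) (measure_spanningSets_lt_top μ n).ne).symm

end IsPoissonProcess

end MmWave

namespace MmWave

/-! ### Exponential variables -/

lemma expMeasure_one_setOf_lt_ofReal (y : ℝ≥0∞) :
    expMeasure 1 {x | y < ENNReal.ofReal x} = expNeg y := by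
  have := isProbabilityMeasure_expMeasure one_pos
  induction y with
  | top => simp
  | coe y =>
    have h1 : {x : ℝ | (y : ℝ≥0∞) < ENNReal.ofReal x} = (Set.Iic (y : ℝ))ᶜ := by
      ext x
      rw [← ENNReal.ofReal_coe_nnreal, Set.mem_ofPred_eq, Set.mem_compl_iff, Set.mem_Iic, not_le,
        ENNReal.ofReal_lt_ofReal_iff_of_nonneg y.coe_nonneg]
    rw [h1, prob_compl_eq_one_sub measurableSet_Iic, ← ofReal_cdf, cdf_expMeasure_eq one_pos,
      if_pos y.coe_nonneg, ← ENNReal.ofReal_one, ← ENNReal.ofReal_sub _ (by simp),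
      ← ENNReal.ofReal_coe_nnreal, expNeg_ofReal y.coe_nonneg]
    simp

/-- An independent exponential variable exceeds `Y` with probability `E[exp (-Y)]`. -/
lemma measure_lt_ofReal_exp {Ω : Type*} {m mΩ : MeasurableSpace Ω} {P : Measure Ω}
    [IsProbabilityMeasure P] {h : Ω → ℝ} (hm : Measurable h) (hlaw : P.map h = expMeasure 1)
    (hle : m ≤ mΩ)
    (hind : Indep (MeasurableSpace.comap h inferInstance) m P) {Y : Ω → ℝ≥0∞}
    (hY : Measurable[m] Y) :
    P {ω | Y ω < ENNReal.ofReal (h ω)} = ∫⁻ ω, expNeg (Y ω) ∂P := by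
  have := isProbabilityMeasure_expMeasure one_pos
  have hY' : Measurable Y := hY.mono hle le_rfl
  have hYh : IndepFun Y h P := indep_of_indep_of_le_left hind.symm hY.comap_le
  have hprod := (indepFun_iff_map_prod_eq_prod_map_map hY'.aemeasurable hm.aemeasurable).1 hYh
  have := Measure.isProbabilityMeasure_map (μ := P) hY'.aemeasurable
  have hS : MeasurableSet {p : ℝ≥0∞ × ℝ | p.1 < ENNReal.ofReal p.2} :=
    measurableSet_lt measurable_fst measurable_snd.ennreal_ofReal
  have h1 : {ω | Y ω < ENNReal.ofReal (h ω)}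
      = (fun ω => (Y ω, h ω)) ⁻¹' {p : ℝ≥0∞ × ℝ | p.1 < ENNReal.ofReal p.2} := rfl
  rw [h1, ← Measure.map_apply (hY'.prodMk hm) hS, hprod, hlaw, Measure.prod_apply hS,
    lintegral_map (measurable_measure_prodMk_left hS) hY']
  exact lintegral_congr fun ω => expMeasure_one_setOf_lt_ofReal _

/-- Exponential tilting: the unit exponential density times exp(-cx) is 1 / (1 + c) times the
exponential density of rate 1 + c. -/
lemma lintegral_expNeg_mul_expMeasure {c : ℝ} (hc : 0 ≤ c) :
    ∫⁻ x, expNeg (ENNReal.ofReal (c * x)) ∂(expMeasure 1) = ENNReal.ofReal (1 / (1 + c)) := by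
  have h1 : expMeasure 1 = volume.withDensity (exponentialPDF 1) := rfl
  have hm : ∀ r, Measurable (exponentialPDF r) := fun r =>
    (measurable_exponentialPDFReal r).ennreal_ofReal
  have h2 : ∀ x, exponentialPDF 1 x * expNeg (ENNReal.ofReal (c * x))
      = ENNReal.ofReal (1 / (1 + c)) * exponentialPDF (1 + c) x := fun x => by
    rcases lt_or_ge x 0 with hx | hx
    · simp [exponentialPDF_of_neg hx]
    · rw [exponentialPDF_of_nonneg hx, exponentialPDF_of_nonneg hx, expNeg_ofReal (by positivity),
        ← ENNReal.ofReal_mul (by positivity), ← ENNReal.ofReal_mul (by positivity), one_mul,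
        ← Real.exp_add, one_div, inv_mul_cancel_left₀ (by positivity)]
      congr 2
      ring
  rw [h1, lintegral_withDensity_eq_lintegral_mul _ (hm 1)
    (by fun_prop)]
  simp only [Pi.mul_apply, h2]
  rw [lintegral_const_mul _ (hm _), lintegral_exponentialPDF_eq_one (by positivity), mul_one]

lemma lintegral_one_sub_expNeg_mul_expMeasure {c : ℝ} (hc : 0 ≤ c) :
    ∫⁻ x, (1 - expNeg (ENNReal.ofReal (c * x))) ∂(expMeasure 1)
      = ENNReal.ofReal (c / (1 + c)) := by
  have := isProbabilityMeasure_expMeasure one_pos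
  rw [lintegral_sub
    (by fun_prop)
    (by rw [lintegral_expNeg_mul_expMeasure hc]; exact ENNReal.ofReal_ne_top)
    (ae_of_all _ fun x => expNeg_le_one _), lintegral_expNeg_mul_expMeasure hc, lintegral_one,
    measure_univ, ← ENNReal.ofReal_one, ← ENNReal.ofReal_sub _ (by positivity)]
  congr 1
  field_simp
  ring

/-! ### Polar coordinates -/

/-- The factor 2π is the dimension times the area π of the unit disc, i.e. the mass of the circle,
and the weight u is the radial Jacobian in dimension two. -/
lemma lintegral_fun_norm_euclideanSpace_two {g : ℝ → ℝ≥0∞} (hg : Measurable g) :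
    ∫⁻ x : EuclideanSpace ℝ (Fin 2), g ‖x‖
      = ENNReal.ofReal (2 * Real.pi) * ∫⁻ u in Set.Ioi (0 : ℝ), ENNReal.ofReal u * g u := by
  have hpre := (volume :
    Measure (EuclideanSpace ℝ (Fin 2))).measurePreserving_homeomorphUnitSphereProd
  have h1 : ∫⁻ x : EuclideanSpace ℝ (Fin 2), g ‖x‖
      = ∫⁻ x : ({(0 : EuclideanSpace ℝ (Fin 2))}ᶜ : Set _), g ‖x.1‖
          ∂((volume : Measure (EuclideanSpace ℝ (Fin 2))).comap (↑)) := by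
    rw [lintegral_subtype_comap (measurableSet_singleton _).compl fun x => g ‖x‖,
      restrict_compl_singleton]
  have h2 := hpre.lintegral_comp_emb (Homeomorph.measurableEmbedding _)
    (fun p => g (p.2 : ℝ))
  have hgs : Measurable fun x : Set.Ioi (0 : ℝ) => g x := hg.comp measurable_subtype_coe
  simp only [homeomorphUnitSphereProd_apply_snd_coe] at h2
  rw [h1, h2, lintegral_prod _ (by fun_prop)]
  simp only
  rw [lintegral_const, Measure.toSphere_apply_univ, EuclideanSpace.volume_ball_fin_two, Measure.volumeIoiPow,
    lintegral_withDensity_eq_lintegral_mul _ (by fun_prop) hgs, finrank_euclideanSpace_fin]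
  have h3 := lintegral_subtype_comap (μ := volume) (measurableSet_Ioi (a := (0 : ℝ)))
    fun u => ENNReal.ofReal u * g u
  simp only [Pi.mul_apply]
  norm_num
  rw [mul_comm, ← h3]

/-! ### Integrals over the marked base stations -/

instance : MeasurableSingletonClass LinkState := ⟨fun _ => trivial⟩

instance : Fintype LinkState where
  elems := Finset.cons .los {.nlos} (by simp)
  complete b := by cases b <;> simp

lemma measurable_linkState {X β : Type*} [MeasurableSpace X] [MeasurableSpace β]
    {s : X → LinkState} (hs : Measurable s) {F : LinkState → X → β} (hF : ∀ b, Measurable (F b)) :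
    Measurable fun x => F (s x) x :=
  (measurable_from_prod_countable_right (f := fun p : LinkState × X => F p.1 p.2) hF).comp
    (hs.prodMk measurable_id)

namespace Network

variable (N : Network)

/-- The LoS probability is a convex combination of `min (18 / r) 1` and 1. -/
lemma losProb_mem {r : ℝ} (hr : 0 ≤ r) : 0 ≤ N.losProb r ∧ N.losProb r ≤ 1 := by
  have h1 : Real.exp (-N.blockage * r) ≤ 1 :=
    Real.exp_le_one_iff.2 (by nlinarith [N.blockage_nonneg])
  have h2 : 0 ≤ min (18 / r) 1 := le_min (by positivity) zero_le_one
  have h3 : min (18 / r) 1 ≤ 1 := min_le_right _ _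
  have h4 := Real.exp_pos (-N.blockage * r)
  unfold losProb
  constructor <;> nlinarith

lemma linkProb_nonneg (b : LinkState) {r : ℝ} (hr : 0 ≤ r) : 0 ≤ N.linkProb b r := by
  have := N.losProb_mem hr
  cases b <;> simp [linkProb, this]

lemma linkProb_le_one (b : LinkState) {r : ℝ} (hr : 0 ≤ r) : N.linkProb b r ≤ 1 := by
  have := N.losProb_mem hr
  cases b <;> simp [linkProb, this]

lemma measurable_linkProb (b : LinkState) : Measurable (N.linkProb b) := by
  have : Measurable N.losProb := by unfold losProb; fun_prop
  cases b
  · exact this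
  · exact measurable_const.sub this

lemma measurable_pathLoss (b : LinkState) : Measurable (N.pathLoss b) := by
  unfold pathLoss; fun_prop

lemma measurable_meanPower (C : ℕ) (k : Tier) (b : LinkState) : Measurable (N.meanPower C k b) :=
  (N.measurable_pathLoss b).const_mul _

lemma measurable_linkProb_marked :
    Measurable fun z : MarkedBS => ENNReal.ofReal (N.linkProb z.2.1 ‖z.1‖) :=
  measurable_linkState (s := fun z : MarkedBS => z.2.1) (by fun_prop)
    (F := fun b z => ENNReal.ofReal (N.linkProb b ‖z.1‖))
    fun b => ((N.measurable_linkProb b).comp (by fun_prop)).ennreal_ofReal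

instance (k : Tier) : SigmaFinite (N.bsIntensity k) := by
  have := isProbabilityMeasure_expMeasure one_pos
  unfold bsIntensity
  have : SigmaFinite (((volume : Measure (EuclideanSpace ℝ (Fin 2))).prod
      ((Measure.count : Measure LinkState).prod (expMeasure 1))).withDensity
      (fun z => ENNReal.ofReal (N.linkProb z.2.1 ‖z.1‖))) :=
    SigmaFinite.withDensity_ofReal _
  -- The scalar is a coerced `NNReal`; in this form instance search finds σ-finiteness.
  change SigmaFinite ((N.density k).toNNReal • (_ : Measure MarkedBS))
  infer_instance

/-- Tonelli reduces an integral over marked stations to radial ones: once the fading is averaged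
out, the integrand depends only on link state and distance, so polar coordinates apply to each state
separately. -/
lemma lintegral_bsIntensity (k : Tier) {f : MarkedBS → ℝ≥0∞} (hf : Measurable f)
    {w : LinkState → ℝ → ℝ≥0∞} (hw : ∀ b, Measurable (w b))
    (hfw : ∀ b x, ∫⁻ t, f (x, b, t) ∂(expMeasure 1) = w b ‖x‖) :
    ∫⁻ z, f z ∂(N.bsIntensity k) = ENNReal.ofReal (2 * Real.pi * N.density k) *
      ∑ b, ∫⁻ u in Set.Ioi 0, ENNReal.ofReal (N.linkProb b u * u) * w b u := by
  have := isProbabilityMeasure_expMeasure one_pos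
  have hd := N.measurable_linkProb_marked
  have hwn : ∀ b, Measurable fun u => ENNReal.ofReal (N.linkProb b u) * w b u := fun b =>
    (N.measurable_linkProb b).ennreal_ofReal.mul (hw b)
  unfold bsIntensity
  rw [lintegral_smul_measure, lintegral_withDensity_eq_lintegral_mul _ hd hf,
    lintegral_prod _ (hd.mul hf).aemeasurable]
  have hm : ∀ x : EuclideanSpace ℝ (Fin 2), Measurable fun y : LinkState × ℝ =>
      ((fun z : MarkedBS => ENNReal.ofReal (N.linkProb z.2.1 ‖z.1‖)) * f) (x, y) := fun x =>
    (hd.mul hf).comp measurable_prodMk_left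
  have hwm : ∀ b, Measurable fun x : EuclideanSpace ℝ (Fin 2) =>
      ENNReal.ofReal (N.linkProb b ‖x‖) * w b ‖x‖ := fun b => (hwn b).comp measurable_norm
  have h1 : ∀ x : EuclideanSpace ℝ (Fin 2),
      ∫⁻ y, ((fun z : MarkedBS => ENNReal.ofReal (N.linkProb z.2.1 ‖z.1‖)) * f) (x, y)
        ∂((Measure.count : Measure LinkState).prod (expMeasure 1))
      = ∑ b, ENNReal.ofReal (N.linkProb b ‖x‖) * w b ‖x‖ := fun x => by
    rw [lintegral_prod _ (hm x).aemeasurable, lintegral_count,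
      tsum_fintype]
    refine Finset.sum_congr rfl fun b _ => ?_
    have hfb : Measurable fun t => f (x, b, t) := hf.comp (by fun_prop)
    rw [← hfw b x, ← lintegral_const_mul _ hfb]
    rfl
  simp_rw [h1]
  rw [lintegral_finsetSum _ fun b _ => hwm b, smul_eq_mul]
  simp_rw [fun b => lintegral_fun_norm_euclideanSpace_two (hwn b)]
  rw [← Finset.mul_sum, ← mul_assoc, mul_comm (2 * Real.pi),
    ENNReal.ofReal_mul (N.density_pos k).le]
  congr 1
  refine Finset.sum_congr rfl fun b _ => setLIntegral_congr_fun measurableSet_Ioi fun u hu => ?_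
  have hu' : (0 : ℝ) < u := hu
  rw [ENNReal.ofReal_mul (N.linkProb_nonneg b hu'.le), ← mul_assoc,
    mul_comm (ENNReal.ofReal u)]

end Network

end MmWave

namespace MmWave

namespace Network

variable (N : Network)

/-! ### Interference and association of one tier -/

/-- Power received from one station of tier `j`. -/
noncomputable def receivedPower (C : ℕ) (j : Tier) (z : MarkedBS) : ℝ≥0∞ :=
  ENNReal.ofReal (N.txPower C j * N.bias j * z.2.2 * N.pathLoss z.2.1 ‖z.1‖)

/-- `∞` if the station `z` of tier `j` is stronger than `M` on average, and `0` otherwise. -/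
noncomputable def exclusionWeight (C : ℕ) (M : ℝ) (j : Tier) (z : MarkedBS) : ℝ≥0∞ :=
  if M < N.meanPower C j z.2.1 ‖z.1‖ then ∞ else 0

/-- Mean number of stations of tier `j` within the exclusion radii. -/
noncomputable def voidMass (C : ℕ) (k : Tier) (a : LinkState) (r : ℝ) (j : Tier) : ℝ≥0∞ :=
  ENNReal.ofReal (2 * Real.pi * N.density j) * ∑ b,
    ∫⁻ u in Set.Ioo 0 (N.exclusionRadius C k a r j b), ENNReal.ofReal (N.linkProb b u * u)

lemma measurable_receivedPower (C : ℕ) (j : Tier) : Measurable (N.receivedPower C j) :=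
  measurable_linkState (s := fun z : MarkedBS => z.2.1) (by fun_prop)
    (F := fun b z => ENNReal.ofReal (N.txPower C j * N.bias j * z.2.2 * N.pathLoss b ‖z.1‖))
    fun b => ((measurable_const.mul (by fun_prop)).mul
      ((N.measurable_pathLoss b).comp (by fun_prop))).ennreal_ofReal

lemma measurable_exclusionWeight (C : ℕ) (M : ℝ) (j : Tier) :
    Measurable (N.exclusionWeight C M j) := by
  refine Measurable.ite (measurableSet_lt measurable_const ?_) measurable_const measurable_const
  exact measurable_linkState (s := fun z : MarkedBS => z.2.1) (by fun_prop)
    (F := fun b z => N.meanPower C j b ‖z.1‖)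
    fun b => (N.measurable_meanPower C j b).comp (by fun_prop)

/-- Together with the complementary case below, this makes `expNeg` of the total weight the
indicator of the event that no station is stronger. -/
lemma tsum_exclusionWeight_eq_zero (C : ℕ) (k : Tier) (a : LinkState) (r : ℝ) (j : Tier)
    {S : Set MarkedBS} (hS : N.NoneStronger C k a r j S) :
    ∑' z : S, N.exclusionWeight C (N.meanPower C k a r) j z = 0 :=
  ENNReal.tsum_eq_zero.2 fun z => if_neg (not_lt.2 (hS z z.2))

lemma tsum_exclusionWeight_eq_top (C : ℕ) (k : Tier) (a : LinkState) (r : ℝ) (j : Tier)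
    {S : Set MarkedBS} (hS : ¬ N.NoneStronger C k a r j S) :
    ∑' z : S, N.exclusionWeight C (N.meanPower C k a r) j z = ∞ := by
  unfold NoneStronger at hS
  push Not at hS
  obtain ⟨z, hz, hlt⟩ := hS
  exact ENNReal.tsum_eq_top_of_eq_top ⟨⟨z, hz⟩, if_pos hlt⟩

/-! ### Power comparison and exclusion radii -/

lemma pathLoss_pos (a : LinkState) {r : ℝ} (hr : 0 < r) : 0 < N.pathLoss a r :=
  mul_pos (N.gain_pos a) (Real.rpow_pos_of_pos hr _)

lemma meanPower_pos {C : ℕ} {k : Tier} (hP : 0 < N.txPower C k) (a : LinkState) {r : ℝ}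
    (hr : 0 < r) : 0 < N.meanPower C k a r :=
  mul_pos (mul_pos hP (N.bias_pos k)) (N.pathLoss_pos a hr)

lemma meanPower_nonneg {C : ℕ} {k : Tier} (hP : 0 < N.txPower C k) (a : LinkState) {r : ℝ}
    (hr : 0 ≤ r) : 0 ≤ N.meanPower C k a r :=
  mul_nonneg (mul_nonneg hP.le (N.bias_pos k).le)
    (mul_nonneg (N.gain_pos a).le (Real.rpow_nonneg hr _))

lemma exclusionRadius_nonneg {C : ℕ} (hP : ∀ k, 0 < N.txPower C k) (k : Tier) (a : LinkState)
    {r : ℝ} (hr : 0 < r) (j : Tier) (b : LinkState) : 0 ≤ N.exclusionRadius C k a r j b := by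
  have := hP k; have := hP j; have := N.bias_pos k; have := N.bias_pos j
  have := N.gain_pos a; have := N.gain_pos b
  unfold exclusionRadius
  positivity

/-- A station is stronger than the serving one if and only if it lies within the exclusion
radius. -/
lemma meanPower_lt_meanPower_iff {C : ℕ} (hP : ∀ k, 0 < N.txPower C k) (k : Tier)
    (a : LinkState) {r : ℝ} (hr : 0 < r) (j : Tier) (b : LinkState) {u : ℝ} (hu : 0 < u) :
    N.meanPower C k a r < N.meanPower C j b u ↔ u < N.exclusionRadius C k a r j b := by
  have hk : 0 < N.txPower C k * N.bias k * N.gain a :=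
    mul_pos (mul_pos (hP k) (N.bias_pos k)) (N.gain_pos a)
  have hj : 0 < N.txPower C j * N.bias j * N.gain b :=
    mul_pos (mul_pos (hP j) (N.bias_pos j)) (N.gain_pos b)
  have hb := N.exponent_pos b
  have hR0 := N.exclusionRadius_nonneg hP k a hr j b
  have hR : N.exclusionRadius C k a r j b ^ (-N.exponent b)
      = N.txPower C k * N.bias k * N.gain a / (N.txPower C j * N.bias j * N.gain b)
        * r ^ (-N.exponent a) := by
    unfold exclusionRadius
    rw [Real.mul_rpow (by positivity) (by positivity), ← Real.rpow_mul (by positivity),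
      ← Real.rpow_mul hr.le]
    congr 1
    · rw [show -1 / N.exponent b * -N.exponent b = 1 by field_simp, Real.rpow_one]
    · congr 1
      field_simp
  -- A zero radius would make the left side of `hR` vanish, as `0 ^ x = 0` for nonzero `x`, while
  -- the right side is positive.
  have hRpos : 0 < N.exclusionRadius C k a r j b := by
    refine hR0.lt_of_ne fun h0 => ?_
    rw [← h0, Real.zero_rpow (by linarith)] at hR
    have : 0 < N.txPower C k * N.bias k * N.gain a / (N.txPower C j * N.bias j * N.gain b)
        * r ^ (-N.exponent a) := by positivity
    linarith
  rw [← Real.rpow_lt_rpow_iff_of_neg hRpos hu (neg_lt_zero.2 hb), hR, div_mul_eq_mul_div,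
    div_lt_iff₀ hj]
  unfold meanPower pathLoss
  constructor <;> intro h <;> linarith

/-- The integrand is at most the radius on a bounded interval. Finiteness gives the association
event positive probability, so the void factor can be cancelled. -/
lemma voidMass_ne_top {C : ℕ} (k : Tier) (a : LinkState) (r : ℝ) (j : Tier) :
    N.voidMass C k a r j ≠ ∞ := by
  refine ENNReal.mul_ne_top ENNReal.ofReal_ne_top (ENNReal.sum_ne_top.2 fun b _ => ?_)
  set R := N.exclusionRadius C k a r j b
  have h1 : ∫⁻ u in Set.Ioo 0 R, ENNReal.ofReal (N.linkProb b u * u)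
      ≤ ∫⁻ u in Set.Ioo 0 R, ENNReal.ofReal R := by
    refine setLIntegral_mono measurable_const fun u hu => ENNReal.ofReal_le_ofReal ?_
    nlinarith [N.linkProb_le_one b hu.1.le, hu.1, hu.2]
  refine ne_top_of_le_ne_top ?_ h1
  rw [setLIntegral_const, Real.volume_Ioo]
  exact ENNReal.mul_ne_top ENNReal.ofReal_ne_top ENNReal.ofReal_ne_top

/-- The exponent of the Laplace transform of the interference of tier `j`, on the event that no
station of tier `j` is stronger than the serving station. -/
lemma lintegral_one_sub_expNeg_bsIntensity {C : ℕ} (hP : ∀ k, 0 < N.txPower C k) (k : Tier)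
    (a : LinkState) {r : ℝ} (hr : 0 < r) (j : Tier) {γ : ℝ} (hγ : 0 ≤ γ) :
    ∫⁻ z, (1 - expNeg (N.exclusionWeight C (N.meanPower C k a r) j z
        + ENNReal.ofReal (γ / N.meanPower C k a r) * N.receivedPower C j z)) ∂(N.bsIntensity j)
      = N.voidMass C k a r j + ENNReal.ofReal (2 * Real.pi * N.density j) *
        ∑ b, ∫⁻ u in Set.Ioi (N.exclusionRadius C k a r j b), ENNReal.ofReal (N.linkProb b u * u *
          (γ / N.meanPower C k a r * N.meanPower C j b u
            / (1 + γ / N.meanPower C k a r * N.meanPower C j b u))) := by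
  have := isProbabilityMeasure_expMeasure one_pos
  set M := N.meanPower C k a r
  have hM0 : 0 < M := N.meanPower_pos (hP k) a hr
  set s := γ / M
  have hs0 : 0 ≤ s := by positivity
  have hwm : ∀ b, Measurable fun u => ENNReal.ofReal
      (s * N.meanPower C j b u / (1 + s * N.meanPower C j b u)) := fun b => by
    have := N.measurable_meanPower C j b
    fun_prop
  have hw : ∀ b, Measurable fun u => if M < N.meanPower C j b u then 1 else
      ENNReal.ofReal (s * N.meanPower C j b u / (1 + s * N.meanPower C j b u)) := fun b =>
    Measurable.ite (measurableSet_lt measurable_const (N.measurable_meanPower C j b))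
      measurable_const (hwm b)
  have hf : Measurable fun z => 1 - expNeg (N.exclusionWeight C M j z
      + ENNReal.ofReal s * N.receivedPower C j z) :=
    measurable_const.sub (measurable_expNeg.comp
      ((N.measurable_exclusionWeight C M j).add ((N.measurable_receivedPower C j).const_mul _)))
  rw [N.lintegral_bsIntensity j hf hw]
  · rw [voidMass, ← mul_add, ← Finset.sum_add_distrib]
    congr 1
    refine Finset.sum_congr rfl fun b _ => ?_
    have hR := N.exclusionRadius_nonneg hP k a hr j b
    have hiff := fun u hu => N.meanPower_lt_meanPower_iff hP k a hr j b (u := u) hu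
    set R := N.exclusionRadius C k a r j b
    -- Only the null set {R} is dropped. Below R the weight is ∞ and 1 - exp(-∞) = 1 gives the void
    -- mass; above R the weight is 0 and only the fading average remains.
    have hsplit : Set.Ioi (0 : ℝ) =ᵐ[volume] (Set.Ioo 0 R ∪ Set.Ioi R : Set ℝ) := by
      have h1 : ∀ᵐ u ∂(volume : Measure ℝ), u ≠ R := by simp [ae_iff]
      filter_upwards [h1] with u hu
      apply propext
      change 0 < u ↔ (0 < u ∧ u < R) ∨ R < u
      rcases lt_trichotomy u R with h | h | h
      · simp [h, h.not_gt]
      · exact absurd h hu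
      · simp [h, hR.trans_lt h]
    rw [setLIntegral_congr hsplit, lintegral_union measurableSet_Ioi
      (Set.disjoint_left.2 fun u hu hu' => lt_asymm hu.2 hu')]
    congr 1
    · refine setLIntegral_congr_fun measurableSet_Ioo fun u hu => ?_
      rw [if_pos ((hiff u hu.1).2 hu.2), mul_one]
    · refine setLIntegral_congr_fun measurableSet_Ioi fun u hu => ?_
      have hu0 : 0 < u := hR.trans_lt hu
      rw [if_neg (mt (hiff u hu0).1 (lt_asymm hu)),
        ← ENNReal.ofReal_mul (mul_nonneg (N.linkProb_nonneg b hu0.le) hu0.le)]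
  · intro b x
    unfold exclusionWeight receivedPower
    by_cases h : M < N.meanPower C j b ‖x‖
    · simp [h]
    · simp only [if_neg h, zero_add]
      rw [← lintegral_one_sub_expNeg_mul_expMeasure
        (mul_nonneg hs0 (N.meanPower_nonneg (hP j) b (norm_nonneg x)))]
      refine lintegral_congr fun t => ?_
      rw [← ENNReal.ofReal_mul hs0]
      congr 3
      unfold meanPower
      ring

/-- With s = γ / M and m the positive mean power of an interferer, sm / (1 + sm) = 1 / (1 + M / (γ
m)); dividing by γ is why γ must be positive. -/
lemma expNeg_interference {C : ℕ} (hP : ∀ k, 0 < N.txPower C k) (k : Tier)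
    (a : LinkState) {r : ℝ} (hr : 0 < r) (j : Tier) {γ : ℝ} (hγ : 0 < γ) :
    expNeg (ENNReal.ofReal (2 * Real.pi * N.density j) *
        ∑ b, ∫⁻ u in Set.Ioi (N.exclusionRadius C k a r j b), ENNReal.ofReal (N.linkProb b u * u *
          (γ / N.meanPower C k a r * N.meanPower C j b u
            / (1 + γ / N.meanPower C k a r * N.meanPower C j b u))))
      = N.interferenceLaplace C k a r γ j := by
  have hM0 : 0 < N.meanPower C k a r := N.meanPower_pos (hP k) a hr
  have h1 : ∀ b, ∫⁻ u in Set.Ioi (N.exclusionRadius C k a r j b),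
      ENNReal.ofReal (N.linkProb b u * u *
          (γ / N.meanPower C k a r * N.meanPower C j b u
            / (1 + γ / N.meanPower C k a r * N.meanPower C j b u)))
      = N.interferenceIntegral C k a r γ j b := fun b => by
    refine setLIntegral_congr_fun measurableSet_Ioi fun u hu => ?_
    have hu0 : 0 < u := (N.exclusionRadius_nonneg hP k a hr j b).trans_lt hu
    have hm := N.meanPower_pos (hP j) b hu0
    congr 1
    rw [div_eq_mul_inv (N.linkProb b u * u)]
    congr 1
    field_simp
    ring
  simp_rw [h1]
  have h2 : (Finset.univ : Finset LinkState) = Finset.cons .los {.nlos} (by simp) := rfl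
  rw [h2, Finset.sum_cons, Finset.sum_singleton]
  rfl

/-! ### Laplace transforms of a single Poisson tier -/

section Tier

variable {Ω : Type*} [MeasurableSpace Ω] {P : Measure Ω} [IsProbabilityMeasure P]

/-- Joint Laplace transform of the interference of tier `j` and the indicator that no station of
tier `j` is stronger than the serving station. -/
lemma lintegral_expNeg_tier {C : ℕ} (hP : ∀ k, 0 < N.txPower C k) (k : Tier)
    (a : LinkState) {r : ℝ} (hr : 0 < r) {j : Tier} {γ : ℝ} (hγ : 0 < γ) {Φ : Ω → Set MarkedBS}
    (hΦ : IsPoissonProcess P (N.bsIntensity j) Φ) :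
    ∫⁻ ω, expNeg (∑' z : Φ ω, N.exclusionWeight C (N.meanPower C k a r) j z
        + ENNReal.ofReal (γ / N.meanPower C k a r) * N.totalReceived C j (Φ ω)) ∂P
      = expNeg (N.voidMass C k a r j) * N.interferenceLaplace C k a r γ j := by
  have h1 : ∀ S : Set MarkedBS, ∑' z : S, N.exclusionWeight C (N.meanPower C k a r) j z
        + ENNReal.ofReal (γ / N.meanPower C k a r) * N.totalReceived C j S
      = ∑' z : S, (N.exclusionWeight C (N.meanPower C k a r) j z
        + ENNReal.ofReal (γ / N.meanPower C k a r) * N.receivedPower C j z) := fun S => by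
    rw [ENNReal.tsum_add, ENNReal.tsum_mul_left]
    rfl
  simp_rw [h1]
  rw [hΦ.lintegral_expNeg_tsum (f := fun z => N.exclusionWeight C (N.meanPower C k a r) j z
        + ENNReal.ofReal (γ / N.meanPower C k a r) * N.receivedPower C j z)
      ((N.measurable_exclusionWeight C _ j).add ((N.measurable_receivedPower C j).const_mul _)),
    N.lintegral_one_sub_expNeg_bsIntensity hP k a hr j hγ.le, expNeg_add,
    N.expNeg_interference hP k a hr j hγ]

lemma lintegral_expNeg_exclusionWeight {C : ℕ} (hP : ∀ k, 0 < N.txPower C k) (k : Tier)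
    (a : LinkState) {r : ℝ} (hr : 0 < r) {j : Tier} {Φ : Ω → Set MarkedBS}
    (hΦ : IsPoissonProcess P (N.bsIntensity j) Φ) :
    ∫⁻ ω, expNeg (∑' z : Φ ω, N.exclusionWeight C (N.meanPower C k a r) j z) ∂P
      = expNeg (N.voidMass C k a r j) := by
  -- At γ = 0 the interference terms vanish and only the void mass is left.
  have h1 := N.lintegral_one_sub_expNeg_bsIntensity hP k a hr j le_rfl
  simp only [zero_div, ENNReal.ofReal_zero, zero_mul, add_zero, mul_zero, lintegral_const,
    Finset.sum_const_zero] at h1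
  rw [hΦ.lintegral_expNeg_tsum (N.measurable_exclusionWeight C _ j), h1]

end Tier

end Network

end MmWave

namespace MmWave

/-! ### Coverage of a link with Rayleigh fading -/

/-- The SINR inequality solved for the fading. Positivity of γ covers I = ∞: both sides are then
false, whereas γ = 0 would turn the product into 0 · ∞ = 0. -/
lemma ofReal_lt_sinr_iff {M γ n : ℝ} (hM : 0 < M) (hγ : 0 < γ) (h : ℝ) (I : ℝ≥0∞) :
    ENNReal.ofReal γ < ENNReal.ofReal (M * h) / (I + ENNReal.ofReal n)
      ↔ ENNReal.ofReal (γ / M) * I + ENNReal.ofReal (γ * n / M) < ENNReal.ofReal h := by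
  have hM' : ENNReal.ofReal M ≠ 0 := by simpa using hM
  rw [ENNReal.lt_div_iff_mul_lt (Or.inr ENNReal.ofReal_ne_top) (Or.inr (by simpa using hγ)),
    ENNReal.ofReal_mul hM.le, mul_comm (ENNReal.ofReal M), ← ENNReal.div_lt_iff (Or.inl hM')
      (Or.inl ENNReal.ofReal_ne_top), ENNReal.mul_div_right_comm, ← ENNReal.ofReal_div_of_pos hM, mul_add,
    ← ENNReal.ofReal_mul (by positivity), div_mul_eq_mul_div]

section Coverage

variable {Ω : Type*} {m mΩ : MeasurableSpace Ω} {P : Measure Ω} {A : Set Ω} {T : Ω → ℝ≥0∞}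

/-- `A` is the zero set of `T`, and `expNeg ∘ T` is its indicator. -/
lemma measure_eq_lintegral_expNeg (hTm : Measurable T) (hT0 : ∀ ω ∈ A, T ω = 0)
    (hT1 : ∀ ω ∉ A, T ω = ∞) : MeasurableSet A ∧ P A = ∫⁻ ω, expNeg (T ω) ∂P := by
  have hA : A = T ⁻¹' {0} := by
    ext ω
    by_cases h : ω ∈ A
    · simp [h, hT0 ω h]
    · simp [h, hT1 ω h]
  have hAm : MeasurableSet A := hA ▸ hTm (measurableSet_singleton 0)
  refine ⟨hAm, ?_⟩
  rw [← lintegral_indicator_one hAm]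
  refine lintegral_congr fun ω => ?_
  by_cases h : ω ∈ A
  · simp [h, hT0 ω h]
  · simp [h, hT1 ω h]

/-- Coverage under Rayleigh fading, on an event `A` encoded by a `{0, ∞}`-valued variable `T`. -/
lemma measure_inter_coverage [IsProbabilityMeasure P] {h : Ω → ℝ} (hm : Measurable h)
    (hlaw : P.map h = expMeasure 1) (hle : m ≤ mΩ)
    (hind : Indep (MeasurableSpace.comap h inferInstance) m P) {I : Ω → ℝ≥0∞}
    (hTm : Measurable[m] T) (hIm : Measurable[m] I) (hT0 : ∀ ω ∈ A, T ω = 0)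
    (hT1 : ∀ ω ∉ A, T ω = ∞) {M γ n : ℝ} (hM : 0 < M) (hγ : 0 < γ) (hn : 0 < n) :
    P (A ∩ {ω | ENNReal.ofReal γ < ENNReal.ofReal (M * h ω) / (I ω + ENNReal.ofReal n)})
      = ENNReal.ofReal (Real.exp (-γ * n / M))
        * ∫⁻ ω, expNeg (T ω + ENNReal.ofReal (γ / M) * I ω) ∂P := by
  -- Off `A` the term `T = ∞` makes the inequality fail, so event and coverage merge into one
  -- comparison with the fading.
  have h1 : A ∩ {ω | ENNReal.ofReal γ < ENNReal.ofReal (M * h ω) / (I ω + ENNReal.ofReal n)}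
      = {ω | ENNReal.ofReal (γ * n / M) + (T ω + ENNReal.ofReal (γ / M) * I ω)
          < ENNReal.ofReal (h ω)} := by
    ext ω
    by_cases hω : ω ∈ A
    · simp only [Set.mem_inter_iff, hω, true_and, Set.mem_ofPred_eq, hT0 ω hω, zero_add,
        ofReal_lt_sinr_iff hM hγ, add_comm (ENNReal.ofReal (γ * n / M))]
    · simp [hω, hT1 ω hω]
  have h2 : Measurable[m] fun ω => T ω + ENNReal.ofReal (γ / M) * I ω :=
    hTm.add (hIm.const_mul _)
  have h3 : Measurable[m] fun ω =>
      ENNReal.ofReal (γ * n / M) + (T ω + ENNReal.ofReal (γ / M) * I ω) :=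
    measurable_const.add h2
  have h4 : Measurable fun ω => expNeg (T ω + ENNReal.ofReal (γ / M) * I ω) :=
    measurable_expNeg.comp (h2.mono hle le_rfl)
  rw [h1, measure_lt_ofReal_exp hm hlaw hle hind h3]
  simp_rw [expNeg_add (ENNReal.ofReal (γ * n / M))]
  rw [lintegral_const_mul _ h4,
    expNeg_ofReal (by positivity)]
  congr 3
  ring

end Coverage

/-! ### Spectral efficiency -/

lemma ofReal_lt_ofReal_mul_logb_iff {x : ℝ≥0∞} (hx : x ≠ ∞) {η ρ : ℝ} (hη : 0 < η) (hρ : 0 ≤ ρ) :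
    ENNReal.ofReal ρ < ENNReal.ofReal (η * Real.logb 2 (1 + x.toReal))
      ↔ ENNReal.ofReal ((2 : ℝ) ^ (ρ / η) - 1) < x := by
  have h1 : 0 ≤ (2 : ℝ) ^ (ρ / η) - 1 :=
    sub_nonneg.2 (Real.one_le_rpow one_le_two (by positivity))
  have h2 : 0 < 1 + x.toReal := by positivity
  rw [ENNReal.ofReal_lt_ofReal_iff_of_nonneg hρ, ENNReal.ofReal_lt_iff_lt_toReal h1 hx,
    ← div_lt_iff₀' hη, Real.lt_logb_iff_rpow_lt one_lt_two h2, sub_lt_iff_lt_add']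

/-- For q = 0 (every request is a cache hit) division by zero gives ∞ unless the numerator is 0,
which matches the threshold 2 ^ 0 - 1 = 0. -/
lemma ofReal_lt_ofReal_mul_logb_div_iff {x : ℝ≥0∞} (hx : x ≠ ∞) {κ ρ q : ℝ} (hκ : 0 < κ)
    (hρ : 0 ≤ ρ) (hq : 0 ≤ q) :
    ENNReal.ofReal ρ < ENNReal.ofReal (κ * Real.logb 2 (1 + x.toReal)) / ENNReal.ofReal q
      ↔ ENNReal.ofReal ((2 : ℝ) ^ (q * ρ / κ) - 1) < x := by
  rw [← ofReal_lt_ofReal_mul_logb_iff hx hκ (mul_nonneg hq hρ)]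
  rcases hq.eq_or_lt with rfl | hq
  · rcases eq_or_ne (ENNReal.ofReal (κ * Real.logb 2 (1 + x.toReal))) 0 with h | h
    · simp [h]
    · simp [ENNReal.div_zero h, pos_iff_ne_zero, h]
  · rw [ENNReal.lt_div_iff_mul_lt (Or.inl (by simpa using hq)) (Or.inl ENNReal.ofReal_ne_top),
      ← ENNReal.ofReal_mul hρ, mul_comm]

namespace Network

variable (N : Network)

lemma hitRatio_le_one {C : ℕ} (hC : C ≤ N.files) : N.hitRatio C ≤ 1 := by
  have h0 : ∀ f : ℕ, (0 : ℝ) ≤ (f : ℝ) ^ (-N.zipfExponent) := fun f =>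
    Real.rpow_nonneg f.cast_nonneg _
  exact div_le_one_of_le₀
    (Finset.sum_le_sum_of_subset_of_nonneg (Finset.Icc_subset_Icc_right hC) fun _ _ _ => h0 _)
    (Finset.sum_nonneg fun _ _ => h0 _)

section Links

variable {Ω : Type*}

lemma accessSINR_ne_top (C : ℕ) (k : Tier) (a : LinkState) (r : ℝ) (h : Ω → ℝ)
    (Φ : Tier → Ω → Set MarkedBS) (ω : Ω) : N.accessSINR C k a r h Φ ω ≠ ∞ :=
  ENNReal.div_ne_top ENNReal.ofReal_ne_top (by simp [N.noise_pos])

lemma backhaulSINR_ne_top (C : ℕ) (a : LinkState) (r : ℝ) (hb : Ω → ℝ)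
    (Ψ : Ω → Set MarkedBS) (ω : Ω) : N.backhaulSINR C a r hb Ψ ω ≠ ∞ :=
  ENNReal.div_ne_top ENNReal.ofReal_ne_top (by simp [N.noise_pos])

/-- `0` on the event that the user is associated with the serving station, `∞` off it. -/
noncomputable def userExclusion (C : ℕ) (k : Tier) (a : LinkState) (r : ℝ)
    (Φ : Tier → Ω → Set MarkedBS) (ω : Ω) : ℝ≥0∞ :=
  ∑' z : Φ .sbs ω, N.exclusionWeight C (N.meanPower C k a r) .sbs z
    + ∑' z : Φ .mbs ω, N.exclusionWeight C (N.meanPower C k a r) .mbs z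

variable {C : ℕ} {k : Tier} {a : LinkState} {r : ℝ} {Φ : Tier → Ω → Set MarkedBS}

lemma userExclusion_eq_zero {ω : Ω} (hω : ω ∈ N.userAssociated C k a r Φ) :
    N.userExclusion C k a r Φ ω = 0 := by
  rw [userExclusion, N.tsum_exclusionWeight_eq_zero C k a r _ (hω .sbs),
    N.tsum_exclusionWeight_eq_zero C k a r _ (hω .mbs), add_zero]

lemma userExclusion_eq_top {ω : Ω} (hω : ω ∉ N.userAssociated C k a r Φ) :
    N.userExclusion C k a r Φ ω = ∞ := by
  obtain ⟨j, hj⟩ := not_forall.1 hω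
  rw [userExclusion, ENNReal.add_eq_top]
  cases j
  · exact Or.inl (N.tsum_exclusionWeight_eq_top C k a r _ hj)
  · exact Or.inr (N.tsum_exclusionWeight_eq_top C k a r _ hj)

end Links

/-! ### Independence and measurability in the random environment -/

namespace IsEnvironment

variable {N} {Ω : Type*} [mΩ : MeasurableSpace Ω] {P : Measure Ω}
  {h : Ω → ℝ} {Φ : Tier → Ω → Set MarkedBS} {hb : Ω → ℝ} {Ψ : Ω → Set MarkedBS}

/-- Joint independence passes to disjoint blocks of the five σ-algebras. Blocks are needed because
the access fading must be independent of both tiers together, and the whole access side of the whole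
backhaul side. -/
lemma indep_iSup (hEnv : N.IsEnvironment P h Φ hb Ψ) {S T : Set (Fin 5)} (hST : Disjoint S T) :
    Indep
      (⨆ i ∈ S, (![MeasurableSpace.comap h inferInstance, pointSigma (Φ .sbs),
        pointSigma (Φ .mbs), MeasurableSpace.comap hb inferInstance, pointSigma Ψ] :
          Fin 5 → MeasurableSpace Ω) i)
      (⨆ i ∈ T, (![MeasurableSpace.comap h inferInstance, pointSigma (Φ .sbs),
        pointSigma (Φ .mbs), MeasurableSpace.comap hb inferInstance, pointSigma Ψ] :
          Fin 5 → MeasurableSpace Ω) i) P := by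
  refine indep_iSup_of_disjoint (fun i => ?_) hEnv.indep hST
  fin_cases i
  · exact hEnv.access_measurable.comap_le
  · exact (hEnv.access_poisson .sbs).pointSigma_le
  · exact (hEnv.access_poisson .mbs).pointSigma_le
  · exact hEnv.backhaul_measurable.comap_le
  · exact hEnv.backhaul_poisson.pointSigma_le

lemma indep_fading_access (hEnv : N.IsEnvironment P h Φ hb Ψ) :
    Indep (MeasurableSpace.comap h inferInstance)
      (pointSigma (Φ .sbs) ⊔ pointSigma (Φ .mbs)) P := by
  have h1 := hEnv.indep_iSup (S := {0}) (T := {1, 2}) (by simp)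
  rw [iSup_singleton, iSup_insert, iSup_singleton] at h1
  exact h1

lemma indep_access_points (hEnv : N.IsEnvironment P h Φ hb Ψ) :
    Indep (pointSigma (Φ .sbs)) (pointSigma (Φ .mbs)) P :=
  hEnv.indep.indep (i := 1) (j := 2) (by decide)

lemma indep_fading_backhaul (hEnv : N.IsEnvironment P h Φ hb Ψ) :
    Indep (MeasurableSpace.comap hb inferInstance) (pointSigma Ψ) P :=
  hEnv.indep.indep (i := 3) (j := 4) (by decide)

lemma indep_access_backhaul (hEnv : N.IsEnvironment P h Φ hb Ψ) :
    Indep (MeasurableSpace.comap h inferInstance ⊔ (pointSigma (Φ .sbs) ⊔ pointSigma (Φ .mbs)))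
      (MeasurableSpace.comap hb inferInstance ⊔ pointSigma Ψ) P := by
  have h1 := hEnv.indep_iSup (S := {0, 1, 2}) (T := {3, 4}) (by simp)
  rw [iSup_insert, iSup_insert, iSup_singleton, iSup_insert, iSup_singleton] at h1
  exact h1

lemma access_le (hEnv : N.IsEnvironment P h Φ hb Ψ) :
    pointSigma (Φ .sbs) ⊔ pointSigma (Φ .mbs) ≤ mΩ :=
  sup_le (hEnv.access_poisson .sbs).pointSigma_le (hEnv.access_poisson .mbs).pointSigma_le

lemma measurable_tsum_access (hEnv : N.IsEnvironment P h Φ hb Ψ) (j : Tier)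
    {f : MarkedBS → ℝ≥0∞} (hf : Measurable f) :
    Measurable[pointSigma (Φ .sbs) ⊔ pointSigma (Φ .mbs)] fun ω => ∑' z : Φ j ω, f z := by
  cases j
  · exact (measurable_tsum_pointSigma (hEnv.access_poisson .sbs).countable hf).mono
      le_sup_left le_rfl
  · exact (measurable_tsum_pointSigma (hEnv.access_poisson .mbs).countable hf).mono
      le_sup_right le_rfl

lemma measurable_userExclusion (hEnv : N.IsEnvironment P h Φ hb Ψ) (C : ℕ) (k : Tier)
    (a : LinkState) (r : ℝ) :
    Measurable[pointSigma (Φ .sbs) ⊔ pointSigma (Φ .mbs)] (N.userExclusion C k a r Φ) :=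
  (hEnv.measurable_tsum_access .sbs (N.measurable_exclusionWeight C _ _)).add
    (hEnv.measurable_tsum_access .mbs (N.measurable_exclusionWeight C _ _))

lemma measurable_accessInterference (hEnv : N.IsEnvironment P h Φ hb Ψ) (C : ℕ) :
    Measurable[pointSigma (Φ .sbs) ⊔ pointSigma (Φ .mbs)]
      fun ω => N.totalReceived C .sbs (Φ .sbs ω) + N.totalReceived C .mbs (Φ .mbs ω) :=
  (hEnv.measurable_tsum_access .sbs (N.measurable_receivedPower C .sbs)).add
    (hEnv.measurable_tsum_access .mbs (N.measurable_receivedPower C .mbs))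

lemma measurable_backhaulExclusion (hEnv : N.IsEnvironment P h Φ hb Ψ) (C : ℕ) (M : ℝ) :
    Measurable[pointSigma Ψ] fun ω => ∑' z : Ψ ω, N.exclusionWeight C M .mbs z :=
  measurable_tsum_pointSigma hEnv.backhaul_poisson.countable (N.measurable_exclusionWeight C _ _)

lemma measurable_backhaulInterference (hEnv : N.IsEnvironment P h Φ hb Ψ) (C : ℕ) :
    Measurable[pointSigma Ψ] fun ω => N.totalReceived C .mbs (Ψ ω) :=
  measurable_tsum_pointSigma hEnv.backhaul_poisson.countable (N.measurable_receivedPower C .mbs)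

lemma measurableSet_userAssociated (hEnv : N.IsEnvironment P h Φ hb Ψ) (C : ℕ) (k : Tier)
    (a : LinkState) (r : ℝ) :
    MeasurableSet[pointSigma (Φ .sbs) ⊔ pointSigma (Φ .mbs)] (N.userAssociated C k a r Φ) :=
  -- Only the measurability half is used, so the zero measure serves as a dummy.
  (measure_eq_lintegral_expNeg (mΩ := pointSigma (Φ .sbs) ⊔ pointSigma (Φ .mbs)) (P := 0)
    (hEnv.measurable_userExclusion C k a r) (fun _ => N.userExclusion_eq_zero)
    (fun _ => N.userExclusion_eq_top)).1

lemma measurableSet_backhaulAssociated (hEnv : N.IsEnvironment P h Φ hb Ψ) (C : ℕ)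
    (b : LinkState) (r : ℝ) :
    MeasurableSet[pointSigma Ψ] (N.backhaulAssociated C b r Ψ) :=
  (measure_eq_lintegral_expNeg (mΩ := pointSigma Ψ) (P := 0)
    (hEnv.measurable_backhaulExclusion C (N.meanPower C .mbs b r))
    (fun _ hω => N.tsum_exclusionWeight_eq_zero C .mbs b r _ hω)
    (fun _ hω => N.tsum_exclusionWeight_eq_top C .mbs b r _ hω)).1

lemma measurable_accessSINR (hEnv : N.IsEnvironment P h Φ hb Ψ) (C : ℕ) (k : Tier)
    (a : LinkState) (r : ℝ) :
    Measurable[MeasurableSpace.comap h inferInstance ⊔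
      (pointSigma (Φ .sbs) ⊔ pointSigma (Φ .mbs))] (N.accessSINR C k a r h Φ) := by
  have h1 : Measurable[MeasurableSpace.comap h inferInstance ⊔
      (pointSigma (Φ .sbs) ⊔ pointSigma (Φ .mbs))] h :=
    (comap_measurable h).mono le_sup_left le_rfl
  exact (((h1.const_mul _).mul_const _).ennreal_ofReal).div
    (((hEnv.measurable_accessInterference C).mono le_sup_right le_rfl).add measurable_const)

lemma measurable_backhaulSINR (hEnv : N.IsEnvironment P h Φ hb Ψ) (C : ℕ) (b : LinkState)
    (r : ℝ) :
    Measurable[MeasurableSpace.comap hb inferInstance ⊔ pointSigma Ψ]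
      (N.backhaulSINR C b r hb Ψ) := by
  have h1 : Measurable[MeasurableSpace.comap hb inferInstance ⊔ pointSigma Ψ] hb :=
    (comap_measurable hb).mono le_sup_left le_rfl
  exact (((h1.const_mul _).mul_const _).ennreal_ofReal).div
    (((hEnv.measurable_backhaulInterference C).mono le_sup_right le_rfl).add measurable_const)

/-! ### Coverage formulas and factorisation over the two links -/

variable [IsProbabilityMeasure P]

/-- Numerator and denominator of the conditional probability both factor over the two independent
tiers, and the void factors of the numerator are exactly the denominator. -/
lemma accessCoverage_eq (hEnv : N.IsEnvironment P h Φ hb Ψ) {C : ℕ}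
    (hP : ∀ k, 0 < N.txPower C k) (k : Tier) (a : LinkState) {r γ : ℝ} (hr : 0 < r)
    (hγ : 0 < γ) :
    N.accessCoverage P C k a r h Φ γ = N.noiseFactor C k a r γ
      * (N.interferenceLaplace C k a r γ .sbs * N.interferenceLaplace C k a r γ .mbs) := by
  have hM := N.meanPower_pos (hP k) a hr
  have hTm := hEnv.measurable_userExclusion C k a r
  have hIm := hEnv.measurable_accessInterference C
  obtain ⟨hAm, hPA⟩ := measure_eq_lintegral_expNeg (P := P) (hTm.mono hEnv.access_le le_rfl)
    (A := N.userAssociated C k a r Φ) (fun _ => N.userExclusion_eq_zero)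
    (fun _ => N.userExclusion_eq_top)
  have hcov := measure_inter_coverage hEnv.access_measurable hEnv.access_law hEnv.access_le
    hEnv.indep_fading_access hTm hIm (A := N.userAssociated C k a r Φ)
    (fun _ => N.userExclusion_eq_zero) (fun _ => N.userExclusion_eq_top) hM hγ N.noise_pos
  have hset : {ω | ENNReal.ofReal γ < N.accessSINR C k a r h Φ ω}
      = {ω | ENNReal.ofReal γ < ENNReal.ofReal (N.meanPower C k a r * h ω)
        / (N.totalReceived C .sbs (Φ .sbs ω) + N.totalReceived C .mbs (Φ .mbs ω)
          + ENNReal.ofReal N.noise)} := by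
    ext ω
    simp only [Set.mem_ofPred_eq, accessSINR, meanPower, mul_right_comm _ (h ω)]
  have hT : ∀ j, Measurable[pointSigma (Φ j)] fun ω =>
      ∑' z : Φ j ω, N.exclusionWeight C (N.meanPower C k a r) j z := fun j =>
    measurable_tsum_pointSigma (hEnv.access_poisson j).countable
      (N.measurable_exclusionWeight C _ _)
  have hR : ∀ j, Measurable[pointSigma (Φ j)] fun ω => N.totalReceived C j (Φ j ω) := fun j =>
    measurable_tsum_pointSigma (hEnv.access_poisson j).countable (N.measurable_receivedPower C j)
  have hprod : ∀ u v : Ω → ℝ≥0∞, Measurable[pointSigma (Φ .sbs)] u →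
      Measurable[pointSigma (Φ .mbs)] v → ∫⁻ ω, expNeg (u ω) * expNeg (v ω) ∂P
        = (∫⁻ ω, expNeg (u ω) ∂P) * ∫⁻ ω, expNeg (v ω) ∂P := fun u v hu hv =>
    lintegral_mul_eq_lintegral_mul_lintegral_of_independent_measurableSpace
      (hEnv.access_poisson .sbs).pointSigma_le (hEnv.access_poisson .mbs).pointSigma_le
      hEnv.indep_access_points (measurable_expNeg.comp hu) (measurable_expNeg.comp hv)
  have hTR : ∀ j, Measurable[pointSigma (Φ j)] fun ω =>
      ∑' z : Φ j ω, N.exclusionWeight C (N.meanPower C k a r) j z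
        + ENNReal.ofReal (γ / N.meanPower C k a r) * N.totalReceived C j (Φ j ω) := fun j =>
    (hT j).add ((hR j).const_mul _)
  have hden : P (N.userAssociated C k a r Φ)
      = expNeg (N.voidMass C k a r .sbs) * expNeg (N.voidMass C k a r .mbs) := by
    rw [hPA]
    simp_rw [userExclusion, expNeg_add]
    rw [hprod _ _ (hT .sbs) (hT .mbs),
      N.lintegral_expNeg_exclusionWeight hP k a hr (hEnv.access_poisson .sbs),
      N.lintegral_expNeg_exclusionWeight hP k a hr (hEnv.access_poisson .mbs)]
  have hsum : ∀ ω, expNeg (N.userExclusion C k a r Φ ω + ENNReal.ofReal (γ / N.meanPower C k a r)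
        * (N.totalReceived C .sbs (Φ .sbs ω) + N.totalReceived C .mbs (Φ .mbs ω)))
      = expNeg (∑' z : Φ .sbs ω, N.exclusionWeight C (N.meanPower C k a r) .sbs z
          + ENNReal.ofReal (γ / N.meanPower C k a r) * N.totalReceived C .sbs (Φ .sbs ω))
        * expNeg (∑' z : Φ .mbs ω, N.exclusionWeight C (N.meanPower C k a r) .mbs z
          + ENNReal.ofReal (γ / N.meanPower C k a r) * N.totalReceived C .mbs (Φ .mbs ω)) :=
    fun ω => by
      rw [← expNeg_add, userExclusion, mul_add, add_add_add_comm]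
  simp_rw [hsum] at hcov
  rw [hprod _ _ (hTR .sbs) (hTR .mbs),
    N.lintegral_expNeg_tier hP k a hr hγ (hEnv.access_poisson .sbs),
    N.lintegral_expNeg_tier hP k a hr hγ (hEnv.access_poisson .mbs), ← hset] at hcov
  have h0 : P (N.userAssociated C k a r Φ) ≠ 0 := by
    rw [hden]
    simp [expNeg_eq_zero_iff, N.voidMass_ne_top]
  -- The void factors are gathered into `P` of the association event, which is nonzero and finite,
  -- and cancelled.
  rw [accessCoverage, cond_apply hAm, hcov, mul_mul_mul_comm, ← hden, mul_left_comm,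
    ← mul_assoc (_⁻¹), ENNReal.inv_mul_cancel h0 (measure_ne_top _ _), one_mul]
  rfl

lemma backhaulCoverage_eq (hEnv : N.IsEnvironment P h Φ hb Ψ) {C : ℕ}
    (hP : ∀ k, 0 < N.txPower C k) (b : LinkState) {r γ : ℝ} (hr : 0 < r) (hγ : 0 < γ) :
    N.backhaulCoverage P C b r hb Ψ γ
      = N.noiseFactor C .mbs b r γ * N.interferenceLaplace C .mbs b r γ .mbs := by
  have hM := N.meanPower_pos (hP .mbs) b hr
  have hle := hEnv.backhaul_poisson.pointSigma_le
  have hTm := hEnv.measurable_backhaulExclusion C (N.meanPower C .mbs b r)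
  have hT0 : ∀ ω ∈ N.backhaulAssociated C b r Ψ, _ := fun ω hω =>
    N.tsum_exclusionWeight_eq_zero C .mbs b r .mbs hω
  have hT1 : ∀ ω ∉ N.backhaulAssociated C b r Ψ, _ := fun ω hω =>
    N.tsum_exclusionWeight_eq_top C .mbs b r .mbs hω
  obtain ⟨hAm, hden⟩ := measure_eq_lintegral_expNeg (P := P) (hTm.mono hle le_rfl) hT0 hT1
  have hcov := measure_inter_coverage hEnv.backhaul_measurable hEnv.backhaul_law hle
    hEnv.indep_fading_backhaul hTm (hEnv.measurable_backhaulInterference C) hT0 hT1 hM hγ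
    N.noise_pos
  have hset : {ω | ENNReal.ofReal γ < N.backhaulSINR C b r hb Ψ ω}
      = {ω | ENNReal.ofReal γ < ENNReal.ofReal (N.meanPower C .mbs b r * hb ω)
        / (N.totalReceived C .mbs (Ψ ω) + ENNReal.ofReal N.noise)} := by
    ext ω
    simp only [Set.mem_ofPred_eq, backhaulSINR, meanPower, mul_right_comm _ (hb ω)]
  rw [N.lintegral_expNeg_tier hP .mbs b hr hγ hEnv.backhaul_poisson, ← hset] at hcov
  rw [N.lintegral_expNeg_exclusionWeight hP .mbs b hr hEnv.backhaul_poisson] at hden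
  have h0 : P (N.backhaulAssociated C b r Ψ) ≠ 0 := by
    rw [hden]
    simp [expNeg_eq_zero_iff, N.voidMass_ne_top]
  rw [backhaulCoverage, cond_apply hAm, hcov, ← hden, mul_left_comm,
    ← mul_assoc (_⁻¹), ENNReal.inv_mul_cancel h0 (measure_ne_top _ _), one_mul]
  rfl

lemma cond_sbsEfficiency (hEnv : N.IsEnvironment P h Φ hb Ψ) {C : ℕ} (hC : C ≤ N.files)
    {η : ℝ} (hη0 : 0 < η) (hη1 : η < 1) (a b : LinkState) (rs rb : ℝ) {ρ : ℝ} (hρ : 0 ≤ ρ) :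
    cond P (N.userAssociated C .sbs a rs Φ ∩ N.backhaulAssociated C b rb Ψ)
        {ω | ENNReal.ofReal ρ < N.sbsEfficiency C η a b rs rb h Φ hb Ψ ω}
      = N.accessCoverage P C .sbs a rs h Φ ((2 : ℝ) ^ (ρ / η) - 1)
        * N.backhaulCoverage P C b rb hb Ψ
            ((2 : ℝ) ^ ((1 - N.hitRatio C) * ρ / (1 - η)) - 1) := by
  have hset : {ω | ENNReal.ofReal ρ < N.sbsEfficiency C η a b rs rb h Φ hb Ψ ω}
      = {ω | ENNReal.ofReal ((2 : ℝ) ^ (ρ / η) - 1) < N.accessSINR C .sbs a rs h Φ ω}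
        ∩ {ω | ENNReal.ofReal ((2 : ℝ) ^ ((1 - N.hitRatio C) * ρ / (1 - η)) - 1)
            < N.backhaulSINR C b rb hb Ψ ω} := by
    ext ω
    simp only [Set.mem_inter_iff, Set.mem_ofPred_eq, sbsEfficiency, lt_min_iff,
      ofReal_lt_ofReal_mul_logb_iff (N.accessSINR_ne_top C .sbs a rs h Φ ω) hη0 hρ,
      ofReal_lt_ofReal_mul_logb_div_iff (N.backhaulSINR_ne_top C b rb hb Ψ ω) (sub_pos.2 hη1) hρ
        (sub_nonneg.2 (N.hitRatio_le_one hC))]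
  have hA := hEnv.measurableSet_userAssociated C .sbs a rs
  have hB := hEnv.measurableSet_backhaulAssociated C b rb
  have hA' := hEnv.access_le _ hA
  have hB' := hEnv.backhaul_poisson.pointSigma_le _ hB
  have hE := (hEnv.measurable_accessSINR C .sbs a rs)
    (measurableSet_Ioi (a := ENNReal.ofReal ((2 : ℝ) ^ (ρ / η) - 1)))
  have hF := (hEnv.measurable_backhaulSINR C b rb) (measurableSet_Ioi
    (a := ENNReal.ofReal ((2 : ℝ) ^ ((1 - N.hitRatio C) * ρ / (1 - η)) - 1)))
  -- Each association event depends on the stations of its own link alone, so it belongs to the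
  -- σ-algebra of that link and is separated from the other link together with its SINR event.
  have hAs := (le_sup_right : _ ≤ MeasurableSpace.comap h inferInstance ⊔
    (pointSigma (Φ .sbs) ⊔ pointSigma (Φ .mbs))) _ hA
  have hBs := (le_sup_right : _ ≤ MeasurableSpace.comap hb inferInstance ⊔ pointSigma Ψ) _ hB
  have hind := (Indep_iff _ _ _).1 hEnv.indep_access_backhaul
  have h1 := hind _ _ hAs hBs
  have h2 := hind _ _ (hAs.inter hE) (hBs.inter hF)
  rw [hset, accessCoverage, backhaulCoverage, cond_apply (hA'.inter hB'), cond_apply hA',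
    cond_apply hB', Set.inter_inter_inter_comm, h1]
  -- Inverses multiply because both measures are finite, so the association events need not have
  -- positive probability here.
  rw [mul_mul_mul_comm, ← ENNReal.mul_inv (Or.inr (measure_ne_top _ _))
    (Or.inl (measure_ne_top _ _))]
  exact congrArg _ h2

end IsEnvironment

end Network

end MmWave

theorem mainTheorem4 {Ω : Type*} [MeasurableSpace Ω] (P : Measure Ω) [IsProbabilityMeasure P]
    (N : MmWave.Network) (C : ℕ) (hC : C ≤ N.files)
    (hPs : 0 < N.txPower C .sbs) (hPm : 0 < N.txPower C .mbs)
    (h : Ω → ℝ) (Φ : MmWave.Tier → Ω → Set MmWave.MarkedBS)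
    (hb : Ω → ℝ) (Ψ : Ω → Set MmWave.MarkedBS)
    (hEnv : N.IsEnvironment P h Φ hb Ψ)
    (η : ℝ) (hη0 : 0 < η) (hη1 : η ≤ 1) :
    -- users served by an SBS: the four LoS/NLoS cases of access link and backhaul link
    (η < 1 → ∀ (a b : MmWave.LinkState) (rs rb ρ : ℝ), 0 < rs → 0 < rb → 0 ≤ ρ →
      cond P (N.userAssociated C .sbs a rs Φ ∩ N.backhaulAssociated C b rb Ψ)
          {ω | ENNReal.ofReal ρ < N.sbsEfficiency C η a b rs rb h Φ hb Ψ ω}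
        = N.accessCoverage P C .sbs a rs h Φ ((2 : ℝ) ^ (ρ / η) - 1)
          * N.backhaulCoverage P C b rb hb Ψ
              ((2 : ℝ) ^ ((1 - N.hitRatio C) * ρ / (1 - η)) - 1)) ∧
    -- users served by an MBS: LoS and NLoS access link
    (∀ (a : MmWave.LinkState) (r ρ : ℝ), 0 < r → 0 ≤ ρ →
      cond P (N.userAssociated C .mbs a r Φ)
          {ω | ENNReal.ofReal ρ < N.mbsEfficiency C η a r h Φ ω}
        = N.accessCoverage P C .mbs a r h Φ ((2 : ℝ) ^ (ρ / η) - 1)) ∧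
    -- the access coverage probabilities
    (∀ (k : MmWave.Tier) (a : MmWave.LinkState) (r γ : ℝ), 0 < r → 0 < γ →
      N.accessCoverage P C k a r h Φ γ
        = N.noiseFactor C k a r γ
          * (N.interferenceLaplace C k a r γ .sbs * N.interferenceLaplace C k a r γ .mbs)) ∧
    -- the backhaul coverage probabilities
    (∀ (b : MmWave.LinkState) (r γ : ℝ), 0 < r → 0 < γ →
      N.backhaulCoverage P C b r hb Ψ γ
        = N.noiseFactor C .mbs b r γ * N.interferenceLaplace C .mbs b r γ .mbs) := by
  have hP : ∀ k, 0 < N.txPower C k := fun k => by cases k <;> assumption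
  refine ⟨fun hη a b rs rb ρ _ _ hρ => hEnv.cond_sbsEfficiency hC hη0 hη a b rs rb hρ,
    fun a r ρ _ hρ => ?_, fun k a r γ hr hγ => hEnv.accessCoverage_eq hP k a hr hγ,
    fun b r γ hr hγ => hEnv.backhaulCoverage_eq hP b hr hγ⟩
  -- Both sides condition on the same association, so it suffices that the rate and SINR events
  -- coincide.
  rw [MmWave.Network.accessCoverage]
  congr 1
  ext ω
  exact MmWave.ofReal_lt_ofReal_mul_logb_iff (N.accessSINR_ne_top C .mbs a r h Φ ω) hη0 hρ
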